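/- An almost contact complex Riemannian (accR) manifold $(M,\varphi,\xi,\eta,g)$ is a smooth $(2n+1)$-dimensional manifold with an endomorphism field $\varphi$, a vector field $\xi$, a 1-form $\eta$ and a pseudo-Riemannian metric $g$ of signature $(n+1,n)$ such that $\varphi\xi=0$, $\varphi^2=-\mathrm{id}+\eta\otimes\xi$, $\eta\circ\varphi=0$, $\eta(\xi)=1$ and $g(\varphi x,\varphi y)=-g(x,y)+\eta(x)\eta(y)$. Its associated metric is $\tilde g(x,y)=g(x,\varphi y)+\eta(x)\eta(y)$. It is an $\mathcal F_0$-manifold if $\nabla\varphi=0$ for the Levi-Civita connection $\nabla$ of $g$. Let $(M,\varphi,\xi,\eta,g)$ be an $\mathcal F_0$-manifold, let $u,v,w$ be smooth functions on $M$, and let $(M,\varphi,\bar\xi,\bar\eta,\bar g)$ be the accR manifold (called a $G(\mathcal F_0)$-manifold) given by $\bar\xi=e^{-w}\xi$, $\bar\eta=e^{w}\eta$ and $$\bar g=e^{2u}\cos 2v\,g+e^{2u}\sin 2v\,\tilde g+\left(e^{2w}-e^{2u}\cos 2v-e^{2u}\sin 2v\right)\eta\otimes\eta .$$ Suppose that $\bar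 g$ generates an almost Riemann soliton with vertical potential $\bar\vartheta=\bar k\,\bar\xi$, where $\bar k$ is a nowhere vanishing smooth function; that is, for a smooth function $\bar\sigma$, $$2\bar R+\bar\sigma\,\bar g\owedge\bar g+\bar g\owedge\mathcal L_{\bar\vartheta}\bar g=0,$$ where $\bar R$ is the $(0,4)$-curvature tensor of $\bar g$ and $(g\owedge h)(x,y,z,t)=g(y,z)h(x,t)-g(x,z)h(y,t)+h(y,z)g(x,t)-h(x,z)g(y,t)$. Let $\bar\rho(y,z)=\bar g^{ij}\bar R(e_i,y,z,e_j)$ be the Ricci tensor, $\bar\tau=\bar g^{ij}\bar\rho_{ij}$ the scalar curvature and $\bar\tau^*=\bar g^{ij}\varphi_j^k\bar\rho_{ik}$ the $*$-scalar curvature of $\bar g$. Then the manifold $(M,\varphi,\bar\xi,\bar\eta,\bar g)$ is almost Einstein-like, i.e. $\bar\rho=a\,\bar g+b\,\tilde{\bar g}+c\,\bar\eta\otimes\bar\eta$ for some functions $a,b,c$ on $M$, if and only if $\bar k=\lambda e^{w}$ on the distribution $\mathcal H=\ker\eta$ with $\lambda$ constant, in the sense that along every differentiable curve tangent to $\mathcal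 H$ (equivalently, on every leaf of the integrable distribution $\mathcal H$) one has $\bar k=\lambda e^{w}$ for a constant $\lambda$, which may depend on the curve (leaf). In that case $$\bar\rho=-\left[2n\bar\sigma+\mathrm d\bar k(\bar\xi)+(4n-1)\bar k\,\mathrm du(\bar\xi)\right]\bar g-(2n-1)\bar k\,\mathrm dv(\bar\xi)\,\tilde{\bar g}-(2n-1)\left\{\mathrm d\bar k(\bar\xi)-\bar k\left[\mathrm du(\bar\xi)+\mathrm dv(\bar\xi)\right]\right\}\bar\eta\otimes\bar\eta,$$ $$\bar\tau=-2n\left[(2n+1)\bar\sigma+2\,\mathrm d\bar k(\bar\xi)+4n\,\bar k\,\mathrm du(\bar\xi)\right],\qquad \bar\tau^*=2n(2n-1)\,\bar k\,\mathrm dv(\bar\xi).$$ -/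

import Mathlib

open scoped Manifold ContDiff

noncomputable section

namespace AccR

/-! ### Tensor calculus in coordinates

Tensor fields on an open subset of `ℝ^d` are functions of the point `y`; `fderiv` gives their
partial derivatives. -/

/-- The coordinate space `ℝ^d`. -/
abbrev V (d : ℕ) : Type := EuclideanSpace ℝ (Fin d)

/-- Bilinear forms on `ℝ^d`. -/
abbrev Bil (d : ℕ) : Type := V d →L[ℝ] V d →L[ℝ] ℝ

/-- The coordinate frame `e_i = ∂/∂x^i`. -/
def frame {d : ℕ} (i : Fin d) : V d := EuclideanSpace.single i 1

/-- The matrix `B_ij = B(e_i, e_j)`. -/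
def gram {d : ℕ} (B : Bil d) : Matrix (Fin d) (Fin d) ℝ :=
  Matrix.of fun i j => B (frame i) (frame j)

/-- The trace `B^{ij} h(e_i, e_j)` of `h` with respect to a nondegenerate form `B`, where `(B^{ij})`
is the inverse matrix of `(B_ij)`. -/
def metricTrace {d : ℕ} (B : Bil d) (h : V d → V d → ℝ) : ℝ :=
  ∑ i, ∑ j, (gram B)⁻¹ i j * h (frame i) (frame j)

/-- Christoffel symbols of the first kind:
`Γ_{abc} = ½ (∂_a g_{bc} + ∂_b g_{ac} - ∂_c g_{ab})`. -/
def christoffelFirst {d : ℕ} (G : V d → Bil d) (y a b c : V d) : ℝ :=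
  (1 / 2) * (fderiv ℝ G y a b c + fderiv ℝ G y b a c - fderiv ℝ G y c a b)

/-- Christoffel symbols of the Levi-Civita connection:
`Γ(a, b) = g^{kl} Γ_{abl} e_k`, that is `∇_{∂_a} ∂_b`. -/
def christoffel {d : ℕ} (G : V d → Bil d) (y a b : V d) : V d :=
  ∑ k, ∑ l, ((gram (G y))⁻¹ k l * christoffelFirst G y a b (frame l)) • (frame k : V d)

/-- The curvature operator
`R(a, b)c = ∂_a Γ(b, c) - ∂_b Γ(a, c) + Γ(a, Γ(b, c)) - Γ(b, Γ(a, c))`, that is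
`∇_a ∇_b c - ∇_b ∇_a c` for coordinate vector fields. -/
def curvatureOp {d : ℕ} (G : V d → Bil d) (y a b c : V d) : V d :=
  fderiv ℝ (fun y' => christoffel G y' b c) y a
    - fderiv ℝ (fun y' => christoffel G y' a c) y b
    + christoffel G y a (christoffel G y b c) - christoffel G y b (christoffel G y a c)

/-- The covariant derivative of an endomorphism field:
`(∇_a φ) b = ∇_a (φ b) - φ (∇_a b) = (∂_a φ) b + Γ(a, φ b) - φ Γ(a, b)`. -/
def covDerivEnd {d : ℕ} (G : V d → Bil d) (Φ : V d → V d →L[ℝ] V d) (y a b : V d) : V d :=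
  fderiv ℝ Φ y a b + christoffel G y a (Φ y b) - Φ y (christoffel G y a b)

/-- The Lie derivative of a `(0,2)`-tensor field along a vector field:
`(L_X G)_{ab} = X^k ∂_k G_{ab} + G_{kb} ∂_a X^k + G_{ak} ∂_b X^k`. -/
def lieDerivBil {d : ℕ} (X : V d → V d) (G : V d → Bil d) (y a b : V d) : ℝ :=
  fderiv ℝ G y (X y) a b + G y (fderiv ℝ X y a) b + G y a (fderiv ℝ X y b)

/-- The Kulkarni–Nomizu product of two `(0,2)`-tensors. -/
def kulkarniNomizu {T : Type*} (g h : T → T → ℝ) (x y z w : T) : ℝ :=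
  g y z * h x w - g x z * h y w + h y z * g x w - h x z * g y w

/-- `B` has signature `(r, s)` on a space of dimension `r + s`: it is positive definite on a
subspace of dimension `r` and negative definite on a subspace of dimension `s`. -/
def HasSignature {d : ℕ} (B : Bil d) (r s : ℕ) : Prop :=
  ∃ P N : Submodule ℝ (V d), Module.finrank ℝ P = r ∧ Module.finrank ℝ N = s ∧
    (∀ x ∈ P, x ≠ 0 → 0 < B x x) ∧ (∀ x ∈ N, x ≠ 0 → B x x < 0)

/-- The associated form `g̃(x, y) = g(x, φ y) + η(x) η(y)`. -/
def assocForm {d : ℕ} (g : Bil d) (φ : V d →L[ℝ] V d) (η : V d →L[ℝ] ℝ) : Bil d :=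
  g.bilinearComp (ContinuousLinearMap.id ℝ (V d)) φ + η.smulRight η

/-- The form
`e^{2u} cos 2v g + e^{2u} sin 2v g̃ + (e^{2w} - e^{2u} cos 2v - e^{2u} sin 2v) η ⊗ η`. -/
def conformalForm {d : ℕ} (g : Bil d) (φ : V d →L[ℝ] V d) (η : V d →L[ℝ] ℝ) (u v w : ℝ) : Bil d :=
  (Real.exp (2 * u) * Real.cos (2 * v)) • g
    + (Real.exp (2 * u) * Real.sin (2 * v)) • assocForm g φ η
    + (Real.exp (2 * w) - Real.exp (2 * u) * Real.cos (2 * v)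
        - Real.exp (2 * u) * Real.sin (2 * v)) • η.smulRight η

set_option synthInstance.maxHeartbeats 200000 in
theorem assocForm_apply {d : ℕ} (g : Bil d) (φ : V d →L[ℝ] V d) (η : V d →L[ℝ] ℝ) (x y : V d) :
    assocForm g φ η x y = g x (φ y) + η x * η y := by
  simp only [assocForm, add_apply]
  simp

theorem conformalForm_apply {d : ℕ} (g : Bil d) (φ : V d →L[ℝ] V d) (η : V d →L[ℝ] ℝ)
    (u v w : ℝ) (x y : V d) :
    conformalForm g φ η u v w x y =
      Real.exp (2 * u) * Real.cos (2 * v) * g x y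
        + Real.exp (2 * u) * Real.sin (2 * v) * (g x (φ y) + η x * η y)
        + (Real.exp (2 * w) - Real.exp (2 * u) * Real.cos (2 * v)
            - Real.exp (2 * u) * Real.sin (2 * v)) * (η x * η y) := by
  simp only [conformalForm, add_apply, smul_apply, assocForm_apply, smul_eq_mul,
    ContinuousLinearMap.smulRight_apply]

theorem conformalForm_symm {d : ℕ} (g : Bil d) (φ : V d →L[ℝ] V d) (η : V d →L[ℝ] ℝ)
    (ξ : V d) (u v w : ℝ) (h1 : φ ξ = 0) (h2 : ∀ x, φ (φ x) = -x + η x • ξ)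
    (h3 : ∀ x, η (φ x) = 0) (h4 : η ξ = 1) (h5 : ∀ x y, g x y = g y x)
    (h6 : ∀ x y, g (φ x) (φ y) = -g x y + η x * η y) (x y : V d) :
    conformalForm g φ η u v w x y = conformalForm g φ η u v w y x := by
  have gξ : ∀ x, g x ξ = η x := fun x => by
    have := h6 x ξ
    simp only [h1, map_zero, h4] at this
    linarith
  have gφ : g (φ x) y = g x (φ y) := by
    have := h6 x (φ y)
    simp only [h2, h3, map_add, map_neg, map_smul, gξ, smul_eq_mul] at this
    linarith
  rw [conformalForm_apply, conformalForm_apply, h5 y x, h5 y (φ x), gφ]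
  ring

theorem conformalForm_phi {d : ℕ} (g : Bil d) (φ : V d →L[ℝ] V d) (η : V d →L[ℝ] ℝ)
    (u v w : ℝ) (h3 : ∀ x, η (φ x) = 0)
    (h6 : ∀ x y, g (φ x) (φ y) = -g x y + η x * η y) (x y : V d) :
    conformalForm g φ η u v w (φ x) (φ y) =
      -conformalForm g φ η u v w x y + Real.exp w * η x * (Real.exp w * η y) := by
  have e2 : Real.exp (2 * w) = Real.exp w ^ 2 := by rw [← Real.exp_nat_mul]; norm_num
  rw [conformalForm_apply, conformalForm_apply, h6 x y, h6 x (φ y), h3, h3, e2]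
  ring

theorem smul_cancel {d : ℕ} (a w : ℝ) (x ξ : V d) :
    -x + a • ξ = -x + (Real.exp w * a) • Real.exp (-w) • ξ := by
  have h : Real.exp w * Real.exp (-w) = 1 := by rw [← Real.exp_add]; simp
  rw [smul_smul, mul_right_comm, h, one_mul]

theorem contDiffOn_conformalForm {d : ℕ} {s : Set (V d)} {g : V d → Bil d}
    {φ : V d → V d →L[ℝ] V d} {η : V d → V d →L[ℝ] ℝ} {u v w : V d → ℝ}
    (hg : ContDiffOn ℝ ∞ g s) (hφ : ContDiffOn ℝ ∞ φ s) (hη : ContDiffOn ℝ ∞ η s)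
    (hu : ContDiffOn ℝ ∞ u s) (hv : ContDiffOn ℝ ∞ v s) (hw : ContDiffOn ℝ ∞ w s) :
    ContDiffOn ℝ ∞ (fun y => conformalForm (g y) (φ y) (η y) (u y) (v y) (w y)) s := by
  refine contDiffOn_clm_apply.mpr fun a => contDiffOn_clm_apply.mpr fun b => ?_
  simp only [conformalForm_apply]
  have h1 : ContDiffOn ℝ ∞ (fun y => g y a b) s := (hg.clm_apply contDiffOn_const).clm_apply
    contDiffOn_const
  have h2 : ContDiffOn ℝ ∞ (fun y => g y a (φ y b)) s := (hg.clm_apply contDiffOn_const).clm_apply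
    (hφ.clm_apply contDiffOn_const)
  have h3 : ContDiffOn ℝ ∞ (fun y => η y a) s := hη.clm_apply contDiffOn_const
  have h4 : ContDiffOn ℝ ∞ (fun y => η y b) s := hη.clm_apply contDiffOn_const
  have c2 : ContDiffOn ℝ ∞ (fun y => Real.exp (2 * u y)) s := (contDiffOn_const.mul hu).exp
  have c3 : ContDiffOn ℝ ∞ (fun y => Real.exp (2 * w y)) s := (contDiffOn_const.mul hw).exp
  have c4 : ContDiffOn ℝ ∞ (fun y => Real.cos (2 * v y)) s := (contDiffOn_const.mul hv).cos
  have c5 : ContDiffOn ℝ ∞ (fun y => Real.sin (2 * v y)) s := (contDiffOn_const.mul hv).sin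
  exact (((c2.mul c4).mul h1).add ((c2.mul c5).mul (h2.add (h3.mul h4)))).add
    (((c3.sub (c2.mul c4)).sub (c2.mul c5)).mul (h3.mul h4))

theorem conformalForm_comp {d : ℕ} (g : Bil d) (φ : V d →L[ℝ] V d) (η : V d →L[ℝ] ℝ)
    (u v w : ℝ) (T S : V d →L[ℝ] V d) (h : ∀ x, T (S x) = x) :
    (conformalForm g φ η u v w).bilinearComp T T =
      conformalForm (g.bilinearComp T T) (S.comp (φ.comp T)) (η.comp T) u v w := by
  ext a b
  simp only [conformalForm_apply, ContinuousLinearMap.bilinearComp_apply,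
    ContinuousLinearMap.comp_apply, h]

/-- The signature of the transformed form: it is the pullback of `g` by an automorphism. -/
theorem conformalForm_signature {d r s : ℕ} (g : Bil d) (φ : V d →L[ℝ] V d) (η : V d →L[ℝ] ℝ)
    (ξ : V d) (u v w : ℝ) (h1 : φ ξ = 0) (h2 : ∀ x, φ (φ x) = -x + η x • ξ)
    (h3 : ∀ x, η (φ x) = 0) (h4 : η ξ = 1) (h5 : ∀ x y, g x y = g y x)
    (h6 : ∀ x y, g (φ x) (φ y) = -g x y + η x * η y) (hg : HasSignature g r s) :
    HasSignature (conformalForm g φ η u v w) r s := by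
  obtain ⟨P, N, hP, hN, hPp, hNn⟩ := hg
  have gξ : ∀ x, g x ξ = η x := fun x => by
    have := h6 x ξ
    simp only [h1, map_zero, h4] at this
    linarith
  have gξ' : ∀ x, g ξ x = η x := fun x => by rw [h5, gξ]
  have gφ : ∀ x y, g (φ x) y = g x (φ y) := fun x y => by
    have := h6 x (φ y)
    simp only [h2, h3, map_add, map_neg, map_smul, gξ, smul_eq_mul] at this
    linarith
  let S : V d →ₗ[ℝ] V d :=
    { toFun := fun x => Real.exp (-u) • (Real.cos v • (x - η x • ξ) - Real.sin v • φ x)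
        + (Real.exp (-w) * η x) • ξ
      map_add' := fun x y => by simp only [map_add]; module
      map_smul' := fun c x => by simp only [map_smul, smul_eq_mul, RingHom.id_apply]; module }
  have hS : ∀ x, S x = Real.exp (-u) • (Real.cos v • (x - η x • ξ) - Real.sin v • φ x)
        + (Real.exp (-w) * η x) • ξ := fun x => rfl
  have key : ∀ x, conformalForm g φ η u v w (S x) (S x) = g x x := by
    intro x
    have e1 : Real.exp (2 * u) = Real.exp u ^ 2 := by rw [← Real.exp_nat_mul]; norm_num
    have e2 : Real.exp (2 * w) = Real.exp w ^ 2 := by rw [← Real.exp_nat_mul]; norm_num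
    have e3 : Real.exp (-u) * Real.exp u = 1 := by rw [← Real.exp_add]; simp
    have e4 : Real.exp (-w) * Real.exp w = 1 := by rw [← Real.exp_add]; simp
    have hc := Real.sin_sq_add_cos_sq v
    rw [conformalForm_apply, hS]
    simp only [map_add, map_sub, map_smul, h1, h2, h3, h4, gξ, gξ', gφ, smul_eq_mul,
      add_apply, sub_apply, smul_apply,
      map_neg, e1, e2, Real.cos_two_mul, Real.sin_two_mul, smul_zero, sub_zero, zero_add, mul_zero,
      add_zero, mul_one, sub_self]
    have n1 := Real.exp_ne_zero u
    have n2 := Real.exp_ne_zero w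
    rw [Real.exp_neg, Real.exp_neg]
    field_simp
    linear_combination Real.exp w ^ 2 * ((2 * Real.cos v ^ 2 + 1) * (g x x - η x ^ 2)
      - 2 * Real.cos v * Real.sin v * g x (φ x)) * hc
  have inj : ∀ x, S x = 0 → x = 0 := by
    intro x hx
    rw [hS] at hx
    have a1 : η x = 0 := by
      have := congrArg η hx
      simp only [map_add, map_sub, map_smul, h3, h4, map_zero, smul_eq_mul] at this
      have h0 := Real.exp_pos (-w)
      have : Real.exp (-w) * η x = 0 := by linarith
      simpa [h0.ne'] using this
    have a2 : Real.cos v • x - Real.sin v • φ x = 0 := by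
      simpa [a1, Real.exp_ne_zero] using hx
    have a3 : Real.cos v • φ x + Real.sin v • x = 0 := by
      have := congrArg φ a2
      simpa [h2, a1] using this
    have a4 : x = (Real.sin v ^ 2 + Real.cos v ^ 2) • x := by simp
    rw [a4]
    calc (Real.sin v ^ 2 + Real.cos v ^ 2) • x
        = Real.cos v • (Real.cos v • x - Real.sin v • φ x)
          + Real.sin v • (Real.cos v • φ x + Real.sin v • x) := by module
      _ = 0 := by rw [a2, a3, smul_zero, smul_zero, add_zero]
  have fr : ∀ W : Submodule ℝ (V d), Module.finrank ℝ (W.map S) = Module.finrank ℝ W := fun W =>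
    
    (Submodule.equivMapOfInjective S (LinearMap.ker_eq_bot.mp
      (LinearMap.ker_eq_bot'.mpr inj)) W).finrank_eq.symm
  refine ⟨P.map S, N.map S, (fr P).trans hP, (fr N).trans hN, ?_, ?_⟩
  · rintro _ ⟨x, hx, rfl⟩ h0
    rw [key]
    exact hPp x hx fun h => h0 (by rw [h, map_zero])
  · rintro _ ⟨x, hx, rfl⟩ h0
    rw [key]
    exact hNn x hx fun h => h0 (by rw [h, map_zero])

/-! ### Tensor fields on manifolds and their coordinate expressions -/

section Manifold

/-- The model with corners of a boundaryless `d`-dimensional manifold. -/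
abbrev Mdl (d : ℕ) : ModelWithCorners ℝ (V d) (V d) := 𝓘(ℝ, V d)

variable {d : ℕ} {M : Type*} [TopologicalSpace M] [ChartedSpace (V d) M]
  [IsManifold (Mdl d) ∞ M]

/-- The differential `df` of a real function at `p`. -/
abbrev diff (f : M → ℝ) (p : M) : TangentSpace (Mdl d) p →L[ℝ] ℝ :=
  mvfderiv (Mdl d) f p

/-- The isomorphism `ℝ^d → T_q M` given by the coordinate frame of the chart at `p`
(for `q` in the domain of this chart; for `q = p` it is the identity of `T_p M = ℝ^d`). -/
def toTangent (p q : M) : V d →L[ℝ] TangentSpace (Mdl d) q :=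
  (trivializationAt (V d) (TangentSpace (Mdl d) : M → Type _) p).symmL ℝ q

/-- The inverse of `toTangent`: components of a tangent vector at `q` in the chart at `p`. -/
def ofTangent (p q : M) : TangentSpace (Mdl d) q →L[ℝ] V d :=
  (trivializationAt (V d) (TangentSpace (Mdl d) : M → Type _) p).continuousLinearMapAt ℝ q

/-- The point of `M` with coordinates `y` in the chart at `p`. -/
def pt (p : M) (y : V d) : M := (extChartAt (Mdl d) p).symm y

/-- Coordinates of the point `p` in the chart at `p`. -/
def coord (p : M) : V d := extChartAt (Mdl d) p p

/-- The coordinate expression of a vector field in the chart at `p`. -/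
def vecC (X : ∀ q : M, TangentSpace (Mdl d) q) (p : M) (y : V d) : V d :=
  ofTangent p (pt p y) (X (pt p y))

/-- The coordinate expression of a 1-form in the chart at `p`. -/
def formC (η : ∀ q : M, TangentSpace (Mdl d) q →L[ℝ] ℝ) (p : M) (y : V d) : V d →L[ℝ] ℝ :=
  (η (pt p y)).comp (toTangent p (pt p y))

/-- The coordinate expression of an endomorphism field in the chart at `p`. -/
def endC (φ : ∀ q : M, TangentSpace (Mdl d) q →L[ℝ] TangentSpace (Mdl d) q) (p : M) (y : V d) :
    V d →L[ℝ] V d :=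
  (ofTangent p (pt p y)).comp ((φ (pt p y)).comp (toTangent p (pt p y)))

/-- The coordinate expression of a `(0,2)`-tensor field in the chart at `p`. -/
def bilC (h : ∀ q : M, TangentSpace (Mdl d) q →L[ℝ] TangentSpace (Mdl d) q →L[ℝ] ℝ) (p : M)
    (y : V d) : Bil d :=
  ContinuousLinearMap.bilinearComp (E := V d) (F := V d) (E' := V d) (F' := V d) (h (pt p y))
    (toTangent p (pt p y)) (toTangent p (pt p y))

/-- Smoothness in all charts of the coordinate expression `T` of a tensor field. -/
def SmoothC {F : Type*} [NormedAddCommGroup F] [NormedSpace ℝ F] (T : M → V d → F) : Prop :=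
  ∀ p : M, ContDiffOn ℝ ∞ (T p) (extChartAt (Mdl d) p).target

/-- A smooth real function on `M`. -/
abbrev SmoothFn (f : M → ℝ) : Prop := ContMDiff (Mdl d) 𝓘(ℝ, ℝ) ∞ f

end Manifold

/-! ### Almost contact complex Riemannian manifolds -/

/-- An almost contact complex Riemannian structure (almost contact B-metric structure) on a
`(2n+1)`-dimensional manifold. -/
structure AccRStructure (n : ℕ) (M : Type*) [TopologicalSpace M] [ChartedSpace (V (2 * n + 1)) M]
    [IsManifold (Mdl (2 * n + 1)) ∞ M] where
  /-- the endomorphism field -/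
  φ : ∀ p : M, TangentSpace (Mdl (2 * n + 1)) p →L[ℝ] TangentSpace (Mdl (2 * n + 1)) p
  /-- the Reeb vector field -/
  ξ : ∀ p : M, TangentSpace (Mdl (2 * n + 1)) p
  /-- the contact 1-form -/
  η : ∀ p : M, TangentSpace (Mdl (2 * n + 1)) p →L[ℝ] ℝ
  /-- the B-metric -/
  g : ∀ p : M, TangentSpace (Mdl (2 * n + 1)) p →L[ℝ] TangentSpace (Mdl (2 * n + 1)) p →L[ℝ] ℝ
  smooth_φ : SmoothC (endC φ)
  smooth_ξ : SmoothC (vecC ξ)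
  smooth_η : SmoothC (formC η)
  smooth_g : SmoothC (bilC g)
  φ_ξ : ∀ p, φ p (ξ p) = 0
  φ_φ : ∀ p x, φ p (φ p x) = -x + η p x • ξ p
  η_φ : ∀ p x, η p (φ p x) = 0
  η_ξ : ∀ p, η p (ξ p) = 1
  g_symm : ∀ p x y, g p x y = g p y x
  g_φ_φ : ∀ p x y, g p (φ p x) (φ p y) = -g p x y + η p x * η p y
  g_signature : ∀ p, HasSignature (d := 2 * n + 1) (g p) (n + 1) n

namespace AccRStructure

variable {n : ℕ} {M : Type*} [TopologicalSpace M] [ChartedSpace (V (2 * n + 1)) M]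
  [IsManifold (Mdl (2 * n + 1)) ∞ M] (A : AccRStructure n M)

/-- The associated B-metric `g̃`. -/
def gTilde (p : M) :
    TangentSpace (Mdl (2 * n + 1)) p →L[ℝ] TangentSpace (Mdl (2 * n + 1)) p →L[ℝ] ℝ :=
  assocForm (A.g p) (A.φ p) (A.η p)

theorem smooth_comp_pt {d : ℕ} {M : Type*} [TopologicalSpace M] [ChartedSpace (V d) M]
    [IsManifold (Mdl d) ∞ M] {f : M → ℝ} (hf : SmoothFn (d := d) f) (p : M) :
    ContDiffOn ℝ ∞ (fun y => f (pt p y)) (extChartAt (Mdl d) p).target :=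
  contMDiffOn_iff_contDiffOn.mp (hf.comp_contMDiffOn (contMDiffOn_extChartAt_symm p))

/-- The contact conformal transformation (`G`-transformation) of `A` determined by the smooth
functions `u`, `v`, `w`: the structure `(φ, ξ̄, η̄, ḡ)` with `ξ̄ = e^{-w} ξ`, `η̄ = e^w η` and
`ḡ = e^{2u} cos 2v g + e^{2u} sin 2v g̃ + (e^{2w} - e^{2u} cos 2v - e^{2u} sin 2v) η ⊗ η`. -/
def gTransform (u v w : M → ℝ) (hu : SmoothFn (d := 2 * n + 1) u)
    (hv : SmoothFn (d := 2 * n + 1) v) (hw : SmoothFn (d := 2 * n + 1) w) : AccRStructure n M where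
  φ := A.φ
  ξ p := Real.exp (-w p) • A.ξ p
  η p := Real.exp (w p) • A.η p
  g p := conformalForm (A.g p) (A.φ p) (A.η p) (u p) (v p) (w p)
  smooth_φ := A.smooth_φ
  smooth_ξ p := by
    have h : vecC (fun q => Real.exp (-w q) • A.ξ q) p
        = fun y => Real.exp (-w (pt p y)) • vecC A.ξ p y := by
      funext y; simp [vecC]
    rw [h]
    exact (smooth_comp_pt hw p).neg.exp.smul (A.smooth_ξ p)
  smooth_η p := by
    have h : formC (fun q => Real.exp (w q) • A.η q) p
        = fun y => Real.exp (w (pt p y)) • formC A.η p y := by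
      funext y; ext x; simp [formC]
    rw [h]
    exact (smooth_comp_pt hw p).exp.smul (A.smooth_η p)
  smooth_g p := by
    have h : Set.EqOn (bilC (fun q => conformalForm (A.g q) (A.φ q) (A.η q) (u q) (v q) (w q)) p)
        (fun y => conformalForm (bilC A.g p y) (endC A.φ p y) (formC A.η p y) (u (pt p y))
          (v (pt p y)) (w (pt p y))) (extChartAt (Mdl (2 * n + 1)) p).target := by
      intro y hy
      have hq : pt p y ∈ (trivializationAt (V (2 * n + 1))
          (TangentSpace (Mdl (2 * n + 1)) : M → Type _) p).baseSet := by
        rw [TangentBundle.trivializationAt_baseSet, ← extChartAt_source (Mdl (2 * n + 1))]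
        exact (extChartAt (Mdl (2 * n + 1)) p).map_target hy
      exact conformalForm_comp _ _ _ _ _ _ (toTangent p (pt p y)) (ofTangent p (pt p y))
        (fun x => Bundle.Trivialization.symmL_continuousLinearMapAt _ hq x)
    exact (contDiffOn_conformalForm (A.smooth_g p) (A.smooth_φ p) (A.smooth_η p)
      (smooth_comp_pt hu p) (smooth_comp_pt hv p) (smooth_comp_pt hw p)).congr h
  φ_ξ p := by simp [A.φ_ξ]
  φ_φ p x := (A.φ_φ p x).trans (smul_cancel (A.η p x) (w p) x (A.ξ p))
  η_φ p x := by simp [A.η_φ]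
  η_ξ p := by
    have h : Real.exp (-w p) * Real.exp (w p) = 1 := by rw [← Real.exp_add]; simp
    simp [A.η_ξ, h]
  g_symm p := conformalForm_symm _ _ _ (A.ξ p) _ _ _ (A.φ_ξ p) (A.φ_φ p) (A.η_φ p)
    (A.η_ξ p) (A.g_symm p) (A.g_φ_φ p)
  g_φ_φ p := conformalForm_phi _ _ _ _ _ _ (A.η_φ p) (A.g_φ_φ p)
  g_signature p := conformalForm_signature _ _ _ (A.ξ p) _ _ _ (A.φ_ξ p) (A.φ_φ p) (A.η_φ p)
    (A.η_ξ p) (A.g_symm p) (A.g_φ_φ p) (A.g_signature p)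

/-- The fundamental tensor `F(x, y, z) = g((∇_x φ) y, z)`. -/
def F (p : M) (x y z : TangentSpace (Mdl (2 * n + 1)) p) : ℝ :=
  A.g p (covDerivEnd (bilC A.g p) (endC A.φ p) (coord p) x y) z

/-- Cosymplectic accR manifolds (the class `𝓕₀`). -/
def IsF0 : Prop := ∀ (p : M) (x y z : TangentSpace (Mdl (2 * n + 1)) p), A.F p x y z = 0

/-- The curvature tensor `R(x, y, z, w) = g(R(x, y)z, w)` of the B-metric. -/
def R (p : M) (x y z w : TangentSpace (Mdl (2 * n + 1)) p) : ℝ :=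
  A.g p (curvatureOp (bilC A.g p) (coord p) x y z) w

/-- The trace `g^{ij} h_{ij}` of a `(0,2)`-tensor at `p`. -/
def trace (p : M) (h : TangentSpace (Mdl (2 * n + 1)) p → TangentSpace (Mdl (2 * n + 1)) p → ℝ) :
    ℝ :=
  metricTrace (d := 2 * n + 1) (A.g p) h

/-- The Ricci tensor `ρ(y, z) = g^{ij} R(e_i, y, z, e_j)`. -/
def ricci (p : M) (y z : TangentSpace (Mdl (2 * n + 1)) p) : ℝ :=
  A.trace p fun x w => A.R p x y z w

/-- The scalar curvature `τ = g^{ij} ρ_{ij}`. -/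
def scal (p : M) : ℝ := A.trace p fun x y => A.ricci p x y

/-- The `*`-scalar curvature `τ* = g^{ij} φ^k_j ρ_{ik}`. -/
def scalStar (p : M) : ℝ := A.trace p fun x y => A.ricci p x (A.φ p y)

/-- The Lie derivative `𝓛_X g` of the B-metric. -/
def lieG (X : ∀ p : M, TangentSpace (Mdl (2 * n + 1)) p) (p : M)
    (x y : TangentSpace (Mdl (2 * n + 1)) p) : ℝ :=
  lieDerivBil (vecC X p) (bilC A.g p) (coord p) x y

/-- `(g, ϑ, σ)` is an almost Riemann soliton: `2R + σ g ∧ g + g ∧ 𝓛_ϑ g = 0`, where `∧` is the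
Kulkarni–Nomizu product. -/
def IsAlmostRiemannSoliton (ϑ : ∀ p : M, TangentSpace (Mdl (2 * n + 1)) p) (σ : M → ℝ) : Prop :=
  SmoothC (vecC ϑ) ∧ SmoothFn (d := 2 * n + 1) σ ∧
    ∀ (p : M) (x y z w : TangentSpace (Mdl (2 * n + 1)) p),
      2 * A.R p x y z w
        + σ p * kulkarniNomizu (fun a b => A.g p a b) (fun a b => A.g p a b) x y z w
        + kulkarniNomizu (fun a b => A.g p a b) (A.lieG ϑ p) x y z w = 0

/-- Almost Einstein-like: `ρ = a g + b g̃ + c η ⊗ η` with functions `a`, `b`, `c`. -/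
def IsAlmostEinsteinLike : Prop :=
  ∃ a b c : M → ℝ, ∀ (p : M) (x y : TangentSpace (Mdl (2 * n + 1)) p),
    A.ricci p x y = a p * A.g p x y + b p * A.gTilde p x y + c p * (A.η p x * A.η p y)

/-- `γ : (s, t) → M` is a differentiable curve tangent to the distribution `𝓗 = ker η`. -/
def IsHorizontalCurve (γ : ℝ → M) (s t : ℝ) : Prop :=
  ∀ r ∈ Set.Ioo s t, MDifferentiableAt 𝓘(ℝ, ℝ) (Mdl (2 * n + 1)) γ r ∧
    A.η (γ r) (mfderiv 𝓘(ℝ, ℝ) (Mdl (2 * n + 1)) γ r (1 : ℝ)) = 0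

/-- `f = λ h` on `𝓗` with `λ` constant: along every curve tangent to `𝓗` (equivalently, on every
leaf of `𝓗` if `𝓗` is integrable) the function `f` is a constant multiple of `h`. -/
def EqConstMulOnH (f h : M → ℝ) : Prop :=
  ∀ (γ : ℝ → M) (s t : ℝ), A.IsHorizontalCurve γ s t →
    ∃ l : ℝ, ∀ r ∈ Set.Ioo s t, f (γ r) = l * h (γ r)

end AccRStructure

end AccR

end

open scoped Manifold ContDiff

noncomputable section

namespace AccR

/-! ### Traces with respect to a nondegenerate symmetric form -/

/-! On an 𝓕₀-manifold `φ` is parallel, hence so are `ξ` and `η`, and the covariant derivative of `ḡ`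
with respect to the connection of `g` comes only from `du`, `dv`, `dw`. Write the potential as `k ξ̄
= (k e^{-w}) ξ`. Its Lie derivative of `ḡ` is then a combination of `ḡ`, its associated metric and
`η̄ ⊗ η̄`, plus `α ⊗ η̄ + η̄ ⊗ α` with the 1-form `α = dk - k dw`
(`ParallelAt.lieDerivBil_conformalForm`, `lieG_gTransform`).

The curvature of `ḡ` is never computed. Contracting the soliton equation expresses `ρ̄` through `ḡ`,
the Lie derivative and its trace (`metricTrace_of_soliton`). So `ρ̄` is of Einstein-like form up to
`-(2n-1)/2 (α ⊗ η̄ + η̄ ⊗ α)` (`ricci_gTransform`). Evaluated on a horizontal vector and `ξ̄`, an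
Einstein-like form vanishes, and since `2n - 1 ≠ 0` this forces `α = 0` on `𝓗`. Conversely, if `α`
vanishes on `𝓗` it is a multiple of `η̄`, and the extra term is absorbed by `η̄ ⊗ η̄`.

Finally `α = e^w d(k e^{-w})`. Thus `α = 0` on `𝓗` means that `k e^{-w}` is constant along
horizontal curves, because every horizontal vector is the velocity of such a curve
(`exists_isHorizontalCurve`, `forall_horizontalCurve_iff`). The formulas for `τ̄` and `τ̄*` are
traces of the formula for `ρ̄`, using `tr φ = 0` and `tr φ² = -2n`. -/

theorem sum_smul_frame {d : ℕ} (x : V d) : ∑ i, x i • (frame i : V d) = x := by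
  have h := (EuclideanSpace.basisFun (Fin d) ℝ).sum_repr x
  simpa [frame] using h

/-- A symmetric form of signature `(r, s)` with `r + s = d` is nondegenerate. -/
theorem HasSignature.eq_zero {d r s : ℕ} {B : Bil d} (hB : HasSignature B r s) (hrs : r + s = d)
    (hsymm : ∀ x y, B x y = B y x) {x : V d} (hx : ∀ y, B x y = 0) : x = 0 := by
  obtain ⟨P, N, hP, hN, hPp, hNn⟩ := hB
  have hdisj : P ⊓ N = ⊥ := by
    rw [Submodule.eq_bot_iff]
    rintro y ⟨hy, hy'⟩
    by_contra h
    exact lt_asymm (hPp y hy h) (hNn y hy' h)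
  have htop : P ⊔ N = ⊤ := by
    apply Submodule.eq_top_of_finrank_eq
    have h := Submodule.finrank_sup_add_finrank_inf_eq P N
    rw [hdisj, finrank_bot] at h
    simp only [finrank_euclideanSpace, Fintype.card_fin]
    omega
  obtain ⟨p, hp, q, hq, rfl⟩ := Submodule.mem_sup.mp (htop ▸ Submodule.mem_top : x ∈ P ⊔ N)
  have h1 := hx p
  have h2 := hx q
  simp only [map_add, add_apply] at h1 h2
  have hp0 : p = 0 := by
    by_contra h
    have h3 := hPp p hp h
    -- Orthogonality of `p + q` to `p` and to `q` gives `B p p = -B p q = B q q`, which is positive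
    -- by `h3` and nonpositive by `h4`.
    have h4 : B q q ≤ 0 := by
      by_cases h0 : q = 0
      · simp [h0]
      · exact (hNn q hq h0).le
    linarith [hsymm p q]
  have hq0 : q = 0 := by
    by_contra h
    have h3 := hNn q hq h
    simp only [hp0, map_zero, zero_apply] at h2
    linarith
  rw [hp0, hq0, add_zero]

/-- A null vector of the transposed Gram matrix is the component vector of an element of the left
radical of `B`. -/
theorem isUnit_det_gram {d : ℕ} {B : Bil d} (hB : ∀ x, (∀ y, B x y = 0) → x = 0) :
    IsUnit (gram B).det := by
  rw [← Matrix.det_transpose, isUnit_iff_ne_zero, Ne, ← Matrix.exists_mulVec_eq_zero_iff]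
  rintro ⟨v, hv, h⟩
  apply hv
  have hx : (∑ i, v i • (frame i : V d)) = 0 := by
    apply hB
    intro y
    rw [← sum_smul_frame y]
    simp only [map_sum, map_smul, sum_apply, smul_apply, smul_eq_mul]
    refine Finset.sum_eq_zero fun j _ => ?_
    have hj := congrFun h j
    simp only [Matrix.mulVec, dotProduct, Matrix.transpose_apply, gram, Matrix.of_apply,
      Pi.zero_apply] at hj
    rw [show ∑ i, v i * B (frame i) (frame j) = ∑ i, B (frame i) (frame j) * v i from
      Finset.sum_congr rfl fun i _ => mul_comm _ _, hj, mul_zero]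
  have h2 : WithLp.toLp 2 v = (0 : V d) := by
    rw [← hx]
    exact (sum_smul_frame (WithLp.toLp 2 v : V d)).symm
  simpa using h2

theorem metricTrace_swap {d : ℕ} {B : Bil d} (hsymm : ∀ x y, B x y = B y x)
    (h : V d → V d → ℝ) : metricTrace B (fun x y => h y x) = metricTrace B h := by
  have hT : (gram B).transpose = gram B := by
    ext i j
    exact hsymm _ _
  have hI : ∀ i j, (gram B)⁻¹ i j = (gram B)⁻¹ j i := fun i j => by
    conv_lhs => rw [← hT, ← Matrix.transpose_nonsing_inv]
    rfl
  unfold metricTrace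
  rw [Finset.sum_comm]
  exact Finset.sum_congr rfl fun i _ => Finset.sum_congr rfl fun j _ => by rw [hI]

/-- The trace of `B(·, T ·)` is the trace of `T`. -/
theorem metricTrace_apply_right {d : ℕ} {B : Bil d} (hsymm : ∀ x y, B x y = B y x)
    (hB : ∀ x, (∀ y, B x y = 0) → x = 0) (T : V d →L[ℝ] V d) :
    metricTrace B (fun x y => B x (T y)) = LinearMap.trace ℝ (V d) T := by
  let b := (EuclideanSpace.basisFun (Fin d) ℝ).toBasis
  have hU := isUnit_det_gram hB
  have hent : ∀ i j, B (frame i) (T (frame j)) = (gram B * LinearMap.toMatrix b b T) i j := by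
    intro i j
    conv_lhs => rw [← sum_smul_frame (T (frame j))]
    simp only [map_sum, map_smul, smul_eq_mul, Matrix.mul_apply, gram, Matrix.of_apply]
    refine Finset.sum_congr rfl fun k _ => ?_
    rw [LinearMap.toMatrix_apply]
    simp [b, frame, mul_comm]
  -- After the swap the double sum reads `tr (B⁻¹ (B T))`, where the Gram matrix cancels.
  rw [← metricTrace_swap hsymm, LinearMap.trace_eq_matrix_trace ℝ b]
  unfold metricTrace
  simp only [hent]
  calc ∑ i, ∑ j, (gram B)⁻¹ i j * (gram B * LinearMap.toMatrix b b T) j i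
      = Matrix.trace ((gram B)⁻¹ * (gram B * LinearMap.toMatrix b b T)) := by
        simp [Matrix.trace, Matrix.mul_apply]
    _ = _ := by rw [Matrix.nonsing_inv_mul_cancel_left _ _ hU]

section Linear

variable {d : ℕ} (B : Bil d)

theorem metricTrace_add (h k : V d → V d → ℝ) :
    metricTrace B (fun x y => h x y + k x y) = metricTrace B h + metricTrace B k := by
  simp only [metricTrace, mul_add, Finset.sum_add_distrib]

theorem metricTrace_const_mul (c : ℝ) (h : V d → V d → ℝ) :
    metricTrace B (fun x y => c * h x y) = c * metricTrace B h := by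
  simp only [metricTrace, Finset.mul_sum]
  exact Finset.sum_congr rfl fun i _ => Finset.sum_congr rfl fun j _ => by ring

end Linear

section Traces

variable {d : ℕ} {B : Bil d} (hsymm : ∀ x y, B x y = B y x)
  (hB : ∀ x, (∀ y, B x y = 0) → x = 0)

include hsymm hB

theorem metricTrace_self : metricTrace B (fun x y => B x y) = d := by
  have h := metricTrace_apply_right hsymm hB (ContinuousLinearMap.id ℝ (V d))
  simpa using h

/-- The form is `B(x, T y)` for the rank-one endomorphism `T = l ⊗ z`, whose trace is `l z`. With `z
= ξ` this traces every term containing `η`. -/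
theorem metricTrace_smulRight (l : V d →L[ℝ] ℝ) (z : V d) :
    metricTrace B (fun x y => B x z * l y) = l z := by
  have h := metricTrace_apply_right hsymm hB (l.smulRight z)
  simp only [ContinuousLinearMap.smulRight_apply, map_smul, smul_eq_mul] at h
  rw [show (fun x y => B x z * l y) = fun x y => l y * B x z from
    funext fun x => funext fun y => mul_comm _ _, h]
  exact LinearMap.trace_smulRight (l : V d →ₗ[ℝ] ℝ) z

/-- The trace of the Kulkarni–Nomizu product with the metric over the outer arguments. -/
theorem metricTrace_kulkarniNomizu {L : Bil d} (hL : ∀ x y, L x y = L y x) (y z : V d) :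
    metricTrace B (fun x t => kulkarniNomizu (fun a b => B a b) (fun a b => L a b) x y z t) =
      metricTrace B (fun x t => L x t) * B y z + (d - 2) * L y z := by
  have h1 := metricTrace_const_mul B (B y z) (fun x t => L x t)
  have h2 := metricTrace_smulRight hsymm hB (L y) z
  have h3 := metricTrace_const_mul B (L y z) (fun x t => B x t)
  have h4 := metricTrace_smulRight hsymm hB (L z) y
  -- In the last Kulkarni–Nomizu term the free argument of `B` is the other one. The two negative
  -- terms each contract to `L y z`, which turns `d` into `d - 2`.
  rw [← metricTrace_swap hsymm] at h4
  rw [metricTrace_self hsymm hB] at h3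
  have e : (fun x t => kulkarniNomizu (fun a b => B a b) (fun a b => L a b) x y z t) =
      fun x t => (B y z * L x t + -1 * (B x z * L y t)) + (L y z * B x t
        + -1 * (B t y * L z x)) := by
    funext x t
    rw [hL z x, hsymm t y]
    simp only [kulkarniNomizu]
    ring
  rw [e, metricTrace_add, metricTrace_add, metricTrace_add, metricTrace_const_mul B (-1),
    metricTrace_const_mul B (-1), h1, h2, h3, h4, hL z y]
  ring

/-- The contraction of the almost Riemann soliton equation `2R + σ B ∧ B + B ∧ L = 0`. -/
theorem metricTrace_of_soliton {L : Bil d} (hL : ∀ x y, L x y = L y x) {σ : ℝ}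
    {R : V d → V d → V d → V d → ℝ}
    (hR : ∀ x y z t, 2 * R x y z t
      + σ * kulkarniNomizu (fun a b => B a b) (fun a b => B a b) x y z t
      + kulkarniNomizu (fun a b => B a b) (fun a b => L a b) x y z t = 0) (y z : V d) :
    2 * metricTrace B (fun x t => R x y z t) =
      -(2 * (d - 1) * σ + metricTrace B (fun x t => L x t)) * B y z - (d - 2) * L y z := by
  have e : (fun x t => R x y z t) = fun x t =>
      (-σ / 2) * kulkarniNomizu (fun a b => B a b) (fun a b => B a b) x y z t
        + (-1 / 2) * kulkarniNomizu (fun a b => B a b) (fun a b => L a b) x y z t := by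
    funext x t
    linarith [hR x y z t]
  -- For `L = B` the contraction is `d + (d - 2) = 2(d - 1)` times `B y z`, whence the coefficient
  -- of `σ`.
  rw [e, metricTrace_add, metricTrace_const_mul, metricTrace_const_mul,
    metricTrace_kulkarniNomizu hsymm hB hL, metricTrace_kulkarniNomizu hsymm hB hsymm,
    metricTrace_self hsymm hB]
  ring

end Traces

/-- A real matrix with `N³ = -N` is traceless, its complex eigenvalues being `0` and `±i`. -/
theorem trace_eq_zero_of_cube {m : Type*} [Fintype m] [DecidableEq m] (N : Matrix m m ℝ)
    (hN : N * N * N = -N) : N.trace = 0 := by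
  let C : Matrix m m ℂ := N.map (algebraMap ℝ ℂ)
  have hC : C * C * C = -C := by
    simp only [C, ← Matrix.map_mul, hN]
    ext i j
    simp
  have htr : C.trace = ((N.trace : ℝ) : ℂ) := by
    simp [C, Matrix.trace]
  have hre : ∀ z ∈ C.charpoly.roots, z.re = 0 := by
    intro z hz
    have hz' : C.charpoly.IsRoot z := Polynomial.isRoot_of_mem_roots hz
    rw [Polynomial.IsRoot.def, Matrix.eval_charpoly, ← Matrix.exists_mulVec_eq_zero_iff] at hz'
    obtain ⟨v, hv, h⟩ := hz'
    have h1 : C.mulVec v = z • v := by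
      rw [Matrix.sub_mulVec, sub_eq_zero] at h
      rw [← h]
      simp
    have h2 : (z * z * z + z) • v = 0 := by
      have h3 := congrArg (fun X => Matrix.mulVec X v) hC
      simp only [← Matrix.mulVec_mulVec, Matrix.neg_mulVec, h1, Matrix.mulVec_smul, smul_smul] at h3
      rw [add_smul, mul_assoc, h3]
      simp
    have h4 : z * (z * z + 1) = 0 := by
      rcases smul_eq_zero.mp h2 with h | h
      · linear_combination h
      · exact absurd h hv
    rcases mul_eq_zero.mp h4 with h | h
    · simp [h]
    -- If `z² = -1`, the imaginary part gives `re z · im z = 0`, and `im z = 0` would give `(re z)²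
    -- = -1`.
    · have hr := congrArg Complex.re h
      have hi := congrArg Complex.im h
      simp only [Complex.add_re, Complex.mul_re, Complex.one_re, Complex.zero_re, Complex.add_im,
        Complex.mul_im, Complex.one_im, Complex.zero_im, add_zero] at hr hi
      have : z.re * z.im = 0 := by linarith
      rcases mul_eq_zero.mp this with h | h
      · exact h
      · rw [h] at hr
        nlinarith
  have hs : ∀ s : Multiset ℂ, (∀ z ∈ s, z.re = 0) → s.sum.re = 0 := by
    intro s
    induction s using Multiset.induction with
    | empty => simp
    | cons a s ih =>
      intro h
      rw [Multiset.sum_cons, Complex.add_re, h a (Multiset.mem_cons_self _ _),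
        ih fun z hz => h z (Multiset.mem_cons_of_mem hz), add_zero]
  have h := hs _ hre
  rw [← Matrix.trace_eq_sum_roots_charpoly, htr] at h
  simpa using h

/-! ### Traces of `φ` and `φ²`. -/

section AlmostContact

variable {d : ℕ} {φ : V d →L[ℝ] V d} {η : V d →L[ℝ] ℝ} {ξ : V d}
  (h1 : φ ξ = 0) (h2 : ∀ x, φ (φ x) = -x + η x • ξ) (h4 : η ξ = 1)

include h1 h2 in
-- Applying `φ` to `φ² = -id + η ⊗ ξ` and using `φ ξ = 0` gives `φ³ = -φ`.
theorem trace_phi : LinearMap.trace ℝ (V d) φ = 0 := by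
  let b := (EuclideanSpace.basisFun (Fin d) ℝ).toBasis
  rw [LinearMap.trace_eq_matrix_trace ℝ b]
  apply trace_eq_zero_of_cube
  rw [← LinearMap.toMatrix_comp, ← LinearMap.toMatrix_comp, ← map_neg]
  congr 1
  ext1 x
  simp [h2, h1]

include h2 h4 in
theorem trace_phi_comp_phi : LinearMap.trace ℝ (V d) (φ.comp φ) = 1 - d := by
  have h : ((φ.comp φ : V d →L[ℝ] V d) : V d →ₗ[ℝ] V d) =
      -LinearMap.id + (η : V d →ₗ[ℝ] ℝ).smulRight ξ := by
    ext1 x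
    simp [h2]
  rw [h, map_add, map_neg, LinearMap.trace_id, LinearMap.trace_smulRight]
  simp [h4]
  ring

end AlmostContact

/-! ### The Levi-Civita connection in coordinates -/

section Christoffel

variable {d : ℕ} {G : V d → Bil d} {y : V d}

theorem fderiv_apply_field {F : Type*} [NormedAddCommGroup F] [NormedSpace ℝ F]
    {T : V d → V d →L[ℝ] F} {X : V d → V d} (hT : DifferentiableAt ℝ T y)
    (hX : DifferentiableAt ℝ X y) (a : V d) :
    fderiv ℝ (fun z => T z (X z)) y a = fderiv ℝ T y a (X y) + T y (fderiv ℝ X y a) := by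
  rw [fderiv_clm_apply hT hX]
  simp [add_comm]

theorem fderiv_apply_const {F : Type*} [NormedAddCommGroup F] [NormedSpace ℝ F]
    {T : V d → V d →L[ℝ] F} (hT : DifferentiableAt ℝ T y) (a b : V d) :
    fderiv ℝ (fun z => T z b) y a = fderiv ℝ T y a b := by
  rw [fderiv_apply_field hT (differentiableAt_const b)]
  simp

theorem fderiv_bil_apply (hG : DifferentiableAt ℝ G y) (c a b : V d) :
    fderiv ℝ (fun z => G z a b) y c = fderiv ℝ G y c a b := by
  rw [fderiv_apply_const (T := fun z => G z a) (hG.clm_apply (differentiableAt_const a)),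
    fderiv_apply_const hG]

theorem fderiv_bil_symm (hG : DifferentiableAt ℝ G y)
    (hs : ∀ᶠ z in nhds y, ∀ a b, G z a b = G z b a) (c a b : V d) : fderiv ℝ G y c a b = fderiv ℝ G y c b a := by
  rw [← fderiv_bil_apply hG, ← fderiv_bil_apply hG]
  have h : (fun z => G z a b) =ᶠ[nhds y] fun z => G z b a := by
    filter_upwards [hs] with z hz using hz a b
  rw [h.fderiv_eq]

theorem christoffelFirst_symm (hs : ∀ c a b, fderiv ℝ G y c a b = fderiv ℝ G y c b a)
    (a b c : V d) : christoffelFirst G y a b c = christoffelFirst G y b a c := by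
  unfold christoffelFirst
  rw [hs c a b]
  ring

/-- The Christoffel symbols of the second kind are characterised by those of the first kind. -/
theorem apply_christoffel (hU : IsUnit (gram (G y)).det) (hs : ∀ a b, G y a b = G y b a)
    (a b c : V d) : G y (christoffel G y a b) c = christoffelFirst G y a b c := by
  have hl : ∀ l, G y (frame l) (christoffel G y a b) = christoffelFirst G y a b (frame l) := by
    intro l
    have h : ∀ i, (gram (G y)).mulVec ((gram (G y))⁻¹.mulVec
        fun j => christoffelFirst G y a b (frame j)) i = christoffelFirst G y a b (frame i) := by
      intro i
      rw [Matrix.mulVec_mulVec, Matrix.mul_nonsing_inv _ hU, Matrix.one_mulVec]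
    rw [← h l]
    simp only [christoffel, map_sum, map_smul, smul_eq_mul, Matrix.mulVec, dotProduct, gram,
      Matrix.of_apply, Finset.mul_sum]
    exact Finset.sum_congr rfl fun i _ => Finset.sum_congr rfl fun j _ => by ring
  have hlin : christoffelFirst G y a b c = ∑ l, c l * christoffelFirst G y a b (frame l) := by
    conv_lhs => rw [← sum_smul_frame c]
    simp only [christoffelFirst, map_sum, map_smul, sum_apply, smul_apply, smul_eq_mul]
    rw [← Finset.sum_add_distrib, ← Finset.sum_sub_distrib, Finset.mul_sum]
    exact Finset.sum_congr rfl fun i _ => by ring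
  rw [hlin, hs]
  conv_lhs => rw [← sum_smul_frame c]
  simp only [map_sum, map_smul, sum_apply, smul_apply, smul_eq_mul, hl]

/-- Torsion-freeness. It later makes the Christoffel terms of the Lie derivative cancel. -/
theorem christoffel_symm (hs : ∀ c a b, fderiv ℝ G y c a b = fderiv ℝ G y c b a)
    (a b : V d) : christoffel G y a b = christoffel G y b a := by
  unfold christoffel
  simp only [christoffelFirst_symm hs a b]

theorem christoffel_smul_left (r : ℝ) (a b : V d) :
    christoffel G y (r • a) b = r • christoffel G y a b := by
  simp only [christoffel, christoffelFirst, Finset.smul_sum, smul_smul, map_smul, smul_apply,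
    smul_eq_mul]
  exact Finset.sum_congr rfl fun i _ => Finset.sum_congr rfl fun j _ => by congr 1; ring

theorem christoffel_zero_right (a : V d) : christoffel G y a 0 = 0 := by
  simp [christoffel, christoffelFirst]

/-- The Levi-Civita connection is metric. -/
theorem fderiv_eq_christoffel (hU : IsUnit (gram (G y)).det) (hs : ∀ a b, G y a b = G y b a)
    (hs' : ∀ c a b, fderiv ℝ G y c a b = fderiv ℝ G y c b a) (a b c : V d) :
    fderiv ℝ G y a b c = G y (christoffel G y a b) c + G y b (christoffel G y a c) := by
  rw [hs b, apply_christoffel hU hs, apply_christoffel hU hs]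
  simp only [christoffelFirst]
  rw [hs' a c b, hs' b a c, hs' c a b]
  ring

end Christoffel

/-! ### The Lie derivative of the transformed metric in coordinates -/

/-- The Lie derivative as a continuous bilinear form. -/
def lieBil {d : ℕ} (X : V d → V d) (G : V d → Bil d) (y : V d) : Bil d :=
  fderiv ℝ G y (X y)
    + (G y).bilinearComp (fderiv ℝ X y) (ContinuousLinearMap.id ℝ (V d))
    + (G y).bilinearComp (ContinuousLinearMap.id ℝ (V d)) (fderiv ℝ X y)

theorem lieBil_apply {d : ℕ} (X : V d → V d) (G : V d → Bil d) (y a b : V d) :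
    lieBil X G y a b = lieDerivBil X G y a b := by
  simp only [lieBil, lieDerivBil, add_apply, ContinuousLinearMap.bilinearComp_apply,
    ContinuousLinearMap.id_apply]

/-- Differentiable almost contact B-metric structures near a point `y` of `ℝ^d` which are
parallel at `y`. -/
structure ParallelAt {d : ℕ} (G : V d → Bil d) (Φ : V d → V d →L[ℝ] V d)
    (ζ : V d → V d) (θ : V d → V d →L[ℝ] ℝ) (y : V d) : Prop where
  diff_G : DifferentiableAt ℝ G y
  diff_Φ : DifferentiableAt ℝ Φ y
  diff_ζ : DifferentiableAt ℝ ζ y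
  diff_θ : DifferentiableAt ℝ θ y
  nondeg : ∀ x, (∀ z, G y x z = 0) → x = 0
  -- The algebraic identities are required on a neighbourhood so that they can be differentiated at
  -- `y`.
  symm : ∀ᶠ z in nhds y, ∀ a b, G z a b = G z b a
  Φ_ζ : ∀ᶠ z in nhds y, Φ z (ζ z) = 0
  Φ_Φ : ∀ᶠ z in nhds y, ∀ x, Φ z (Φ z x) = -x + θ z x • ζ z
  θ_Φ : ∀ᶠ z in nhds y, ∀ x, θ z (Φ z x) = 0
  θ_ζ : ∀ᶠ z in nhds y, θ z (ζ z) = 1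
  G_ΦΦ : ∀ᶠ z in nhds y, ∀ a b, G z (Φ z a) (Φ z b) = -G z a b + θ z a * θ z b
  parallel : ∀ a b, covDerivEnd G Φ y a b = 0

namespace ParallelAt

variable {d : ℕ} {G : V d → Bil d} {Φ : V d → V d →L[ℝ] V d}
    {ζ : V d → V d} {θ : V d → V d →L[ℝ] ℝ} {y : V d} (h : ParallelAt G Φ ζ θ y)

include h

/-- Put `b = ζ` in the compatibility of `G` with `Φ`; the left side vanishes because `Φ ζ = 0`. -/
theorem eventually_apply_ζ : ∀ᶠ z in nhds y, ∀ a, G z a (ζ z) = θ z a := by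
  filter_upwards [h.Φ_ζ, h.θ_ζ, h.G_ΦΦ] with z h1 h2 h3 a
  have h4 := h3 a (ζ z)
  rw [h1, map_zero, h2] at h4
  linarith

theorem fderiv_symm (c a b : V d) : fderiv ℝ G y c a b = fderiv ℝ G y c b a :=
  fderiv_bil_symm h.diff_G h.symm c a b

theorem fderiv_G (a b c : V d) :
    fderiv ℝ G y a b c = G y (christoffel G y a b) c + G y b (christoffel G y a c) :=
  fderiv_eq_christoffel (isUnit_det_gram h.nondeg) h.symm.self_of_nhds h.fderiv_symm a b c

theorem fderiv_Φ (a b : V d) :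
    fderiv ℝ Φ y a b = Φ y (christoffel G y a b) - christoffel G y a (Φ y b) := by
  have := h.parallel a b
  unfold covDerivEnd at this
  rw [sub_eq_zero] at this
  exact eq_sub_of_add_eq this

/-- The Reeb field is parallel. -/
theorem fderiv_ζ (a : V d) : fderiv ℝ ζ y a = -christoffel G y a (ζ y) := by
  -- `D` is `∇_a ξ`. Differentiating `φ ξ = 0` gives `φ D = 0`, differentiating `g(ξ, ξ) = 1` gives
  -- `η(D) = 0`, and then `φ² D = -D + η(D) ξ` gives `D = 0`.
  set D := fderiv ℝ ζ y a + christoffel G y a (ζ y) with hD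
  have h1 : Φ y D = 0 := by
    have e : (fun z => Φ z (ζ z)) =ᶠ[nhds y] fun _ => 0 := h.Φ_ζ
    have e1 := e.fderiv_eq (𝕜 := ℝ)
    have e2 := DFunLike.congr_fun e1 a
    rw [fderiv_apply_field h.diff_Φ h.diff_ζ] at e2
    simp [h.fderiv_Φ, h.Φ_ζ.self_of_nhds, christoffel_zero_right] at e2
    rw [hD, map_add, add_comm, e2]
  have h2 : G y (ζ y) D = 0 := by
    have e : (fun z => G z (ζ z) (ζ z)) =ᶠ[nhds y] fun _ => 1 := by
      filter_upwards [h.eventually_apply_ζ, h.θ_ζ] with z e1 e2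
      rw [e1, e2]
    have e1 := e.fderiv_eq (𝕜 := ℝ)
    have e2 := DFunLike.congr_fun e1 a
    rw [fderiv_apply_field (T := fun z => G z (ζ z)) (h.diff_G.clm_apply h.diff_ζ) h.diff_ζ,
      fderiv_apply_field h.diff_G h.diff_ζ] at e2
    simp [h.fderiv_G] at e2
    have s := h.symm.self_of_nhds
    rw [s _ (ζ y), s _ (ζ y)] at e2
    rw [hD, map_add]
    linarith
  have h3 : D = 0 := by
    have e := h.Φ_Φ.self_of_nhds D
    rw [h1, map_zero, ← h.eventually_apply_ζ.self_of_nhds, h.symm.self_of_nhds, h2] at e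
    simpa using e
  exact eq_neg_of_add_eq_zero_left h3

/-- The form `η = g(·, ξ)` is parallel because `g` and `ξ` are. -/
theorem fderiv_θ (a b : V d) : fderiv ℝ θ y a b = θ y (christoffel G y a b) := by
  have e : (fun z => θ z b) =ᶠ[nhds y] fun z => G z b (ζ z) := by
    filter_upwards [h.eventually_apply_ζ] with z e1
    rw [e1]
  have e2 := DFunLike.congr_fun (e.fderiv_eq (𝕜 := ℝ)) a
  rw [fderiv_apply_const h.diff_θ, fderiv_apply_field (T := fun z => G z b)
    (h.diff_G.clm_apply (differentiableAt_const b)) h.diff_ζ, fderiv_apply_const h.diff_G] at e2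
  simp [h.fderiv_G, h.fderiv_ζ] at e2
  rw [e2, h.eventually_apply_ζ.self_of_nhds]

/-- The Lie derivative of the transformed metric along `f ξ`. -/
theorem lieDerivBil_conformalForm {u v w f : V d → ℝ} (hu : DifferentiableAt ℝ u y)
    (hv : DifferentiableAt ℝ v y) (hw : DifferentiableAt ℝ w y) (hf : DifferentiableAt ℝ f y)
    (hd : DifferentiableAt ℝ
      (fun z => conformalForm (G z) (Φ z) (θ z) (u z) (v z) (w z)) y) (a b : V d) :
    lieDerivBil (fun z => f z • ζ z)
        (fun z => conformalForm (G z) (Φ z) (θ z) (u z) (v z) (w z)) y a b =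
      2 * f y * fderiv ℝ u y (ζ y) * conformalForm (G y) (Φ y) (θ y) (u y) (v y) (w y) a b
      + 2 * f y * fderiv ℝ v y (ζ y) *
        (conformalForm (G y) (Φ y) (θ y) (u y) (v y) (w y) a (Φ y b)
          + Real.exp (2 * w y) * (θ y a * θ y b))
      + 2 * Real.exp (2 * w y) * f y *
        (fderiv ℝ w y (ζ y) - fderiv ℝ u y (ζ y) - fderiv ℝ v y (ζ y)) * (θ y a * θ y b)
      + Real.exp (2 * w y) * (fderiv ℝ f y a * θ y b + θ y a * fderiv ℝ f y b) := by
  have s := h.symm.self_of_nhds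
  have gζ := h.eventually_apply_ζ.self_of_nhds
  have gζ' : ∀ x, G y (ζ y) x = θ y x := fun x => by rw [s, gζ]
  have hθΦ := h.θ_Φ.self_of_nhds
  have hΦζ := h.Φ_ζ.self_of_nhds
  have hΦΦ := h.Φ_Φ.self_of_nhds
  have hθζ := h.θ_ζ.self_of_nhds
  have hX : ∀ c, fderiv ℝ (fun z => f z • ζ z) y c
      = f y • (-christoffel G y c (ζ y)) + fderiv ℝ f y c • ζ y := by
    intro c
    rw [fderiv_fun_smul hf h.diff_ζ]
    simp [h.fderiv_ζ]
  -- The first two terms are the Christoffel part and the rest is `∇_c ḡ`. Varying `u` scales `ḡ -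
  -- e^{2w} η ⊗ η`. Varying `v` rotates `(cos 2v, sin 2v)`, which amounts to replacing `ḡ(a, b)` by
  -- `ḡ(a, φ b)`. Varying `w` scales `e^{2w} η ⊗ η`.
  have hG : ∀ c, fderiv ℝ (fun z => conformalForm (G z) (Φ z) (θ z) (u z) (v z) (w z)) y c a b =
      conformalForm (G y) (Φ y) (θ y) (u y) (v y) (w y) (christoffel G y c a) b
        + conformalForm (G y) (Φ y) (θ y) (u y) (v y) (w y) a (christoffel G y c b)
        + 2 * fderiv ℝ u y c * (conformalForm (G y) (Φ y) (θ y) (u y) (v y) (w y) a b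
          - Real.exp (2 * w y) * (θ y a * θ y b))
        + 2 * fderiv ℝ v y c * conformalForm (G y) (Φ y) (θ y) (u y) (v y) (w y) a (Φ y b)
        + 2 * fderiv ℝ w y c * Real.exp (2 * w y) * (θ y a * θ y b) := by
    intro c
    rw [← fderiv_bil_apply hd]
    simp only [conformalForm_apply]
    have d1 : DifferentiableAt ℝ (fun z => G z a) y :=
      h.diff_G.clm_apply (differentiableAt_const a)
    have d2 : DifferentiableAt ℝ (fun z => Φ z b) y :=
      h.diff_Φ.clm_apply (differentiableAt_const b)
    have g1 := (d1.clm_apply (differentiableAt_const b)).hasFDerivAt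
    have g2 := (d1.clm_apply d2).hasFDerivAt
    have g3 := (h.diff_θ.clm_apply (differentiableAt_const a)).hasFDerivAt
    have g4 := (h.diff_θ.clm_apply (differentiableAt_const b)).hasFDerivAt
    have c1 := (hu.hasFDerivAt.const_mul 2).exp.mul (hv.hasFDerivAt.const_mul 2).cos
    have c2 := (hu.hasFDerivAt.const_mul 2).exp.mul (hv.hasFDerivAt.const_mul 2).sin
    have c3 := (hw.hasFDerivAt.const_mul 2).exp
    have t := DFunLike.congr_fun (((c1.mul g1).add (c2.mul (g2.add (g3.mul g4)))).add
      (((c3.sub c1).sub c2).mul (g3.mul g4))).fderiv c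
    refine Eq.trans (by exact t) ?_
    simp only [add_apply, sub_apply, smul_apply, smul_eq_mul,
      fderiv_apply_field d1 d2, fderiv_bil_apply h.diff_G, fderiv_apply_const h.diff_G,
      fderiv_apply_const h.diff_θ, fderiv_apply_const h.diff_Φ]
    simp only [h.fderiv_G, h.fderiv_Φ, h.fderiv_θ, map_sub, Pi.mul_apply, Pi.add_apply,
      Pi.sub_apply, hΦΦ, hθΦ, map_add, map_neg, map_smul, gζ, smul_eq_mul]
    ring
  unfold lieDerivBil
  rw [hG, hX, hX]
  simp only [map_add, map_neg, map_smul, add_apply, smul_apply, neg_apply, smul_eq_mul]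
  -- By symmetry of the connection the Christoffel terms of `∂_X ḡ` cancel those of `∂X`; what `∂X`
  -- still contributes is `df` paired with `ḡ(ξ, ·) = e^{2w} η`.
  have e1 : ∀ c, christoffel G y (f y • ζ y) c = f y • christoffel G y c (ζ y) := fun c => by
    rw [christoffel_smul_left, christoffel_symm h.fderiv_symm]
  rw [e1, e1]
  simp only [conformalForm_apply, map_smul, smul_apply, smul_eq_mul, hΦΦ, hθΦ, map_add,
      map_neg, gζ, gζ', hΦζ, hθζ, map_zero]
  ring

end ParallelAt

/-! ### Coordinate expressions near the centre of a chart -/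

section Coordinates

variable {d : ℕ} {M : Type*} [TopologicalSpace M] [ChartedSpace (V d) M]

theorem pt_coord (p : M) : pt p (coord (d := d) p) = p :=
  (extChartAt (Mdl d) p).left_inv (mem_extChartAt_source p)

theorem target_mem_nhds (p : M) : (extChartAt (Mdl d) p).target ∈ nhds (coord (d := d) p) :=
  extChartAt_target_mem_nhds p

variable [IsManifold (Mdl d) ∞ M]

theorem toTangent_self (p : M) (x : V d) : toTangent p p x = x := by
  have h := TangentBundle.symmL_trivializationAt_eq_core (I := Mdl d) (b₀ := p) (b := p)
    (mem_chart_source _ p)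
  rw [toTangent, h]
  exact (tangentBundleCore (Mdl d) M).coordChange_self _ _ (mem_chart_source _ p) x

theorem ofTangent_self (p : M) (x : TangentSpace (Mdl d) p) : ofTangent p p x = x := by
  have h := TangentBundle.continuousLinearMapAt_trivializationAt_eq_core (I := Mdl d) (b₀ := p)
    (b := p) (mem_chart_source _ p)
  rw [ofTangent, h]
  exact (tangentBundleCore (Mdl d) M).coordChange_self _ _ (mem_chart_source _ p) x

theorem pt_mem_baseSet {p : M} {y : V d} (hy : y ∈ (extChartAt (Mdl d) p).target) :
    pt p y ∈ (trivializationAt (V d) (TangentSpace (Mdl d) : M → Type _) p).baseSet := by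
  rw [TangentBundle.trivializationAt_baseSet, ← extChartAt_source (Mdl d)]
  exact (extChartAt (Mdl d) p).map_target hy

theorem toTangent_ofTangent {p : M} {y : V d} (hy : y ∈ (extChartAt (Mdl d) p).target)
    (x : TangentSpace (Mdl d) (pt p y)) : toTangent p (pt p y) (ofTangent p (pt p y) x) = x :=
  Bundle.Trivialization.symmL_continuousLinearMapAt _ (pt_mem_baseSet hy) x

theorem ofTangent_toTangent {p : M} {y : V d} (hy : y ∈ (extChartAt (Mdl d) p).target)
    (x : V d) : ofTangent p (pt p y) (toTangent p (pt p y) x) = x :=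
  Bundle.Trivialization.continuousLinearMapAt_symmL _ (pt_mem_baseSet hy) x

/-- The trivialization is the identity over its own centre. Since `pt p (coord p)` equals `p` only
propositionally, the point is generalised before substituting; the next lemmas do likewise. -/
theorem vecC_coord (X : ∀ q : M, TangentSpace (Mdl d) q) (p : M) : vecC X p (coord p) = X p := by
  have h : ∀ q, q = p → ∀ hq : q = p, ofTangent p q (X q) = (X p : V d) := by
    rintro q rfl -
    exact ofTangent_self q _
  exact h _ (pt_coord p) (pt_coord p)

theorem formC_coord (η : ∀ q : M, TangentSpace (Mdl d) q →L[ℝ] ℝ) (p : M) (x : V d) :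
    formC η p (coord p) x = η p x := by
  have h : ∀ q, q = p → η q (toTangent p q x) = η p x := by
    rintro q rfl
    rw [toTangent_self]
  exact h _ (pt_coord p)

theorem endC_coord (φ : ∀ q : M, TangentSpace (Mdl d) q →L[ℝ] TangentSpace (Mdl d) q) (p : M)
    (x : V d) : endC φ p (coord p) x = φ p x := by
  have h : ∀ q, q = p → ofTangent p q (φ q (toTangent p q x)) = (φ p x : V d) := by
    rintro q rfl
    rw [toTangent_self, ofTangent_self]
  exact h _ (pt_coord p)

theorem bilC_coord (h : ∀ q : M, TangentSpace (Mdl d) q →L[ℝ] TangentSpace (Mdl d) q →L[ℝ] ℝ)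
    (p : M) (x y : V d) : bilC h p (coord p) x y = h p x y := by
  have h : ∀ q, q = p → h q (toTangent p q x) (toTangent p q y) = h p x y := by
    rintro q rfl
    rw [toTangent_self, toTangent_self]
  exact h _ (pt_coord p)

omit [IsManifold (Mdl d) ∞ M] in
theorem diff_eq_fderiv {f : M → ℝ} (hf : SmoothFn (d := d) f) (p : M) (x : V d) :
    diff f p x = fderiv ℝ (fun y => f (pt p y)) (coord p) x := by
  have h := (hf.mdifferentiableAt (by simp) : MDifferentiableAt (Mdl d) 𝓘(ℝ, ℝ) f p).mvfderiv
  have h2 := DFunLike.congr_fun h x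
  simp only [ModelWithCorners.range_eq_univ, fderivWithin_univ] at h2
  exact h2

omit [IsManifold (Mdl d) ∞ M] in
theorem SmoothC.differentiableAt {F : Type*} [NormedAddCommGroup F] [NormedSpace ℝ F]
    {T : M → V d → F} (hT : SmoothC T) (p : M) : DifferentiableAt ℝ (T p) (coord p) :=
  ((hT p).contDiffAt (target_mem_nhds p)).differentiableAt (by simp)

end Coordinates

theorem differentiableAt_comp_pt {d : ℕ} {M : Type*} [TopologicalSpace M] [ChartedSpace (V d) M]
    [IsManifold (Mdl d) ∞ M] {f : M → ℝ} (hf : SmoothFn (d := d) f) (p : M) :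
    DifferentiableAt ℝ (fun y => f (pt p y)) (coord (d := d) p) :=
  ((AccRStructure.smooth_comp_pt hf p).contDiffAt (target_mem_nhds p)).differentiableAt (by simp)

theorem smoothFn_mul_exp_neg {d : ℕ} {M : Type*} [TopologicalSpace M] [ChartedSpace (V d) M]
    {k w : M → ℝ} (hk : SmoothFn (d := d) k) (hw : SmoothFn (d := d) w) :
    SmoothFn (d := d) fun q => k q * Real.exp (-w q) :=
  hk.mul (Real.contDiff_exp.contMDiff.comp hw.neg)

theorem diff_mul_exp_neg {d : ℕ} {M : Type*} [TopologicalSpace M] [ChartedSpace (V d) M]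
    [IsManifold (Mdl d) ∞ M] {k w : M → ℝ} (hk : SmoothFn (d := d) k) (hw : SmoothFn (d := d) w)
    (p : M) (x : V d) :
    diff (fun q => k q * Real.exp (-w q)) p x
      = Real.exp (-w p) * (diff k p x - k p * diff w p x) := by
  have dk := differentiableAt_comp_pt hk p
  have dw := differentiableAt_comp_pt hw p
  rw [diff_eq_fderiv hk, diff_eq_fderiv hw, diff_eq_fderiv (smoothFn_mul_exp_neg hk hw)]
  refine (DFunLike.congr_fun (dk.hasFDerivAt.mul dw.hasFDerivAt.neg.exp).fderiv x).trans ?_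
  simp only [add_apply, smul_apply, neg_apply, Pi.neg_apply, smul_eq_mul, pt_coord]
  ring

/-- Only germs matter; this is needed because the coordinate formula for the transformed metric is
available only on the chart target. -/
theorem lieDerivBil_congr {d : ℕ} {X X' : V d → V d} {G G' : V d → Bil d} {y : V d}
    (hX : X =ᶠ[nhds y] X') (hG : G =ᶠ[nhds y] G') (a b : V d) :
    lieDerivBil X G y a b = lieDerivBil X' G' y a b := by
  unfold lieDerivBil
  rw [hX.fderiv_eq, hG.fderiv_eq, hX.eq_of_nhds, hG.eq_of_nhds]

/-! ### From the coordinate computation to the transformed structure on the manifold. -/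

namespace AccRStructure

variable {n : ℕ} {M : Type*} [TopologicalSpace M] [ChartedSpace (V (2 * n + 1)) M]
  [IsManifold (Mdl (2 * n + 1)) ∞ M] (A : AccRStructure n M)

theorem g_eq_zero {p : M} {x : TangentSpace (Mdl (2 * n + 1)) p} (hx : ∀ y, A.g p x y = 0) :
    x = 0 :=
  (A.g_signature p).eq_zero (by omega) (A.g_symm p) hx

theorem g_ξ (p : M) (x : TangentSpace (Mdl (2 * n + 1)) p) : A.g p x (A.ξ p) = A.η p x := by
  have h := A.g_φ_φ p x (A.ξ p)
  rw [A.φ_ξ, map_zero, A.η_ξ] at h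
  linarith

theorem η_vecC {p : M} {y : V (2 * n + 1)} (hy : y ∈ (extChartAt (Mdl (2 * n + 1)) p).target)
    (X : ∀ q : M, TangentSpace (Mdl (2 * n + 1)) q) :
    formC A.η p y (vecC X p y) = A.η (pt p y) (X (pt p y)) := by
  simp only [formC, vecC, ContinuousLinearMap.comp_apply]
  rw [toTangent_ofTangent hy]

/-- Nondegeneracy of `g` turns `F = 0` into `∇φ = 0`. The other identities transfer to the whole
chart target, where the coordinate frame is invertible. -/
theorem parallelAt (hA : A.IsF0) (p : M) :
    ParallelAt (bilC A.g p) (endC A.φ p) (vecC A.ξ p) (formC A.η p) (coord p) where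
  diff_G := SmoothC.differentiableAt A.smooth_g p
  diff_Φ := SmoothC.differentiableAt A.smooth_φ p
  diff_ζ := SmoothC.differentiableAt A.smooth_ξ p
  diff_θ := SmoothC.differentiableAt A.smooth_η p
  nondeg x hx := A.g_eq_zero (p := p) fun z => (bilC_coord A.g p x z).symm.trans (hx z)
  symm := Filter.Eventually.of_forall fun z a b => A.g_symm _ _ _
  Φ_ζ := by
    filter_upwards [target_mem_nhds p] with z hz
    simp only [endC, vecC, ContinuousLinearMap.comp_apply]
    rw [toTangent_ofTangent hz, A.φ_ξ, map_zero]
  Φ_Φ := by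
    filter_upwards [target_mem_nhds p] with z hz x
    simp only [endC, vecC, formC, ContinuousLinearMap.comp_apply]
    rw [toTangent_ofTangent hz, A.φ_φ, map_add, map_neg, map_smul, ofTangent_toTangent hz]
  θ_Φ := by
    filter_upwards [target_mem_nhds p] with z hz x
    simp only [endC, formC, ContinuousLinearMap.comp_apply]
    rw [toTangent_ofTangent hz, A.η_φ]
  θ_ζ := by
    filter_upwards [target_mem_nhds p] with z hz
    rw [A.η_vecC hz, A.η_ξ]
  G_ΦΦ := by
    filter_upwards [target_mem_nhds p] with z hz a b
    have h := A.g_φ_φ (pt p z) (toTangent p (pt p z) a) (toTangent p (pt p z) b)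
    rw [← toTangent_ofTangent hz (A.φ _ (toTangent p (pt p z) a)),
      ← toTangent_ofTangent hz (A.φ _ (toTangent p (pt p z) b))] at h
    exact h
  parallel a b := A.g_eq_zero (p := p) fun z => hA p a b z

section Transform

variable {u v w : M → ℝ} (hu : SmoothFn (d := 2 * n + 1) u)
  (hv : SmoothFn (d := 2 * n + 1) v) (hw : SmoothFn (d := 2 * n + 1) w)

theorem bilC_gTransform {p : M} {y : V (2 * n + 1)}
    (hy : y ∈ (extChartAt (Mdl (2 * n + 1)) p).target) :
    bilC (A.gTransform u v w hu hv hw).g p y =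
      conformalForm (bilC A.g p y) (endC A.φ p y) (formC A.η p y) (u (pt p y))
          (v (pt p y)) (w (pt p y)) :=
  conformalForm_comp _ _ _ _ _ _ (toTangent p (pt p y)) (ofTangent p (pt p y))
    (fun x => toTangent_ofTangent hy x)

theorem vecC_smul_ξ_gTransform (k : M → ℝ) (p : M) (y : V (2 * n + 1)) :
    vecC (fun q => k q • (A.gTransform u v w hu hv hw).ξ q) p y =
      (k (pt p y) * Real.exp (-w (pt p y))) • vecC A.ξ p y := by
  simp [vecC, gTransform, smul_smul]

/-- The Lie derivative of the transformed metric along `k ξ̄`, for an `𝓕₀`-manifold. -/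
theorem lieG_gTransform (hA : A.IsF0) {k : M → ℝ} (hk : SmoothFn (d := 2 * n + 1) k)
    {B : AccRStructure n M} (hB : B = A.gTransform u v w hu hv hw) (p : M)
    (a b : TangentSpace (Mdl (2 * n + 1)) p) :
    B.lieG (fun q => k q • B.ξ q) p a b =
      2 * k p * diff u p (B.ξ p) * B.g p a b
      + 2 * k p * diff v p (B.ξ p) * B.gTilde p a b
      + 2 * k p * (diff w p (B.ξ p) - diff u p (B.ξ p) - diff v p (B.ξ p))
        * (B.η p a * B.η p b)
      + ((diff k p a - k p * diff w p a) * B.η p b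
        + B.η p a * (diff k p b - k p * diff w p b)) := by
  have hgerm : bilC B.g p =ᶠ[nhds (coord (d := 2 * n + 1) p)] fun y =>
      conformalForm (bilC A.g p y) (endC A.φ p y) (formC A.η p y) (u (pt p y)) (v (pt p y)) (w (pt p y)) := by
    filter_upwards [target_mem_nhds p] with y hy
    rw [hB, A.bilC_gTransform hu hv hw hy]
  have hX : vecC (fun q => k q • B.ξ q) p =
      fun y => (k (pt p y) * Real.exp (-w (pt p y))) • vecC A.ξ p y := by
    subst hB
    exact funext fun y => A.vecC_smul_ξ_gTransform hu hv hw k p y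
  have dw := differentiableAt_comp_pt hw p
  have df := differentiableAt_comp_pt (smoothFn_mul_exp_neg hk hw) p
  -- The factor of `ξ` is `f = k e^{-w}`, and `e^{2w} df ⊗ η = (dk - k dw) ⊗ η̄`.
  have hf' : ∀ c, fderiv ℝ (fun y : V (2 * n + 1) => k (pt p y) * Real.exp (-w (pt p y)))
      (coord p) c = Real.exp (-w p) * (diff (d := 2 * n + 1) k p c
        - k p * diff (d := 2 * n + 1) w p c) := fun c =>
    (diff_eq_fderiv (smoothFn_mul_exp_neg hk hw) p c).symm.trans (diff_mul_exp_neg hk hw p c)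
  have main := fun a b : V (2 * n + 1) => (A.parallelAt hA p).lieDerivBil_conformalForm
    (differentiableAt_comp_pt hu p) (differentiableAt_comp_pt hv p) dw df
    (hgerm.differentiableAt_iff.mp (SmoothC.differentiableAt B.smooth_g p)) a b
  have hbil : ∀ x y : V (2 * n + 1), conformalForm (bilC A.g p (coord p)) (endC A.φ p (coord p))
      (formC A.η p (coord p)) (u p) (v p) (w p) x y = B.g p x y := by
    intro x y
    have h := hgerm.eq_of_nhds
    rw [pt_coord] at h
    rw [← h]
    exact bilC_coord B.g p x y
  have hee : Real.exp (-w p) * Real.exp (w p) = 1 := by rw [← Real.exp_add]; simp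
  have e2 : Real.exp (2 * w p) = Real.exp (w p) * Real.exp (w p) := by
    rw [← Real.exp_add]; ring_nf
  have hξ : ∀ l : TangentSpace (Mdl (2 * n + 1)) p →L[ℝ] ℝ,
      l (B.ξ p) = Real.exp (-w p) * l (A.ξ p) := by
    intro l
    subst hB
    exact l.map_smul _ _
  have hη : ∀ x, B.η p x = Real.exp (w p) * A.η p x := by
    subst hB
    exact fun x => rfl
  have hφ : B.φ = A.φ := by
    subst hB
    rfl
  have hT : B.gTilde p a b = B.g p a (A.φ p b) + B.η p a * B.η p b := by
    rw [← hφ]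
    exact assocForm_apply _ _ _ _ _
  have qu := (diff_eq_fderiv hu p (A.ξ p)).symm
  have qv := (diff_eq_fderiv hv p (A.ξ p)).symm
  have qw := (diff_eq_fderiv hw p (A.ξ p)).symm
  have qθ := formC_coord A.η p
  have qΦ : ∀ b : V (2 * n + 1), endC A.φ p (coord p) b = A.φ p b := endC_coord A.φ p
  simp only [pt_coord, vecC_coord, hf', hbil] at main
  have hL : B.lieG (fun q => k q • B.ξ q) p a b = _ :=
    (lieDerivBil_congr (Filter.EventuallyEq.of_eq hX) hgerm a b).trans (main a b)
  have e : B.g p a (endC A.φ p (coord p) b) = B.g p a (A.φ p b) := congrArg (B.g p a) (qΦ b)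
  rw [hL, e]
  have e3 := qθ a
  have e4 := qθ b
  rw [qu, qv, qw, e3, e4, hT, hξ, hξ, hξ, hη, hη, e2]
  linear_combination Real.exp (w p) * ((diff k p a - k p * diff w p a) * A.η p b
    + A.η p a * (diff k p b - k p * diff w p b)) * hee

end Transform
end AccRStructure

/-! ### Horizontal curves and functions constant along them. -/

section Curves

variable {d : ℕ} {M : Type*} [TopologicalSpace M] [ChartedSpace (V d) M]
  [IsManifold (Mdl d) ∞ M]

/-- The differential of the coordinate parametrisation is the coordinate frame. -/
theorem hasMFDerivAt_pt {p : M} {y : V d} (hy : y ∈ (extChartAt (Mdl d) p).target) :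
    HasMFDerivAt (Mdl d) (Mdl d) (pt (d := d) p) y (toTangent p (pt p y)) := by
  have h := (mdifferentiableWithinAt_extChartAt_symm (I := Mdl d) hy).hasMFDerivWithinAt
  have hs : pt p y ∈ (chartAt (V d) p).source := by
    rw [← extChartAt_source (Mdl d)]
    exact (extChartAt (Mdl d) p).map_target hy
  have h2 := TangentBundle.symmL_trivializationAt (I := Mdl d) hs
  have h3 : extChartAt (Mdl d) p (pt p y) = y := (extChartAt (Mdl d) p).right_inv hy
  rw [h3] at h2
  rw [← h2, ModelWithCorners.range_eq_univ] at h
  exact hasMFDerivWithinAt_univ.mp h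

end Curves

namespace AccRStructure

variable {n : ℕ} {M : Type*} [TopologicalSpace M] [ChartedSpace (V (2 * n + 1)) M]
  [IsManifold (Mdl (2 * n + 1)) ∞ M] (A : AccRStructure n M)

/-- Every horizontal vector is tangent to a horizontal curve. -/
theorem exists_isHorizontalCurve (p : M) (x : V (2 * n + 1)) (hx : A.η p x = 0) :
    ∃ c : ℝ → V (2 * n + 1), ∃ ε > 0, c 0 = coord p ∧ HasDerivAt c x 0 ∧
      A.IsHorizontalCurve (fun r => pt p (c r)) (-ε) ε := by
  -- The constant field `x` projected to `𝓗` along `ξ`. It is C¹, so it has an integral curve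
  -- through `p`, with velocity `x` there because `η(x) = 0`. Integrability of `𝓗` plays no role.
  have hX : ContDiffAt ℝ 1 (fun y => x - formC A.η p y x • vecC A.ξ p y) (coord p) := by
    have h1 := ((A.smooth_η p).contDiffAt (target_mem_nhds p)).of_le
      (by exact_mod_cast le_top : (1 : WithTop ℕ∞) ≤ ∞)
    have h2 := ((A.smooth_ξ p).contDiffAt (target_mem_nhds p)).of_le
      (by exact_mod_cast le_top : (1 : WithTop ℕ∞) ≤ ∞)
    exact contDiffAt_const.sub ((h1.clm_apply contDiffAt_const).smul h2)
  obtain ⟨c, hc0, ε, hε, hc⟩ :=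
    hX.exists_forall_mem_closedBall_exists_eq_forall_mem_Ioo_hasDerivAt₀ 0
  simp only [zero_sub, zero_add] at hc
  have hcont : ContinuousAt c 0 := (hc 0 ⟨neg_lt_zero.mpr hε, hε⟩).continuousAt
  have hev := hcont.eventually_mem (hc0.symm ▸ target_mem_nhds p)
  obtain ⟨δ, hδ, hδ'⟩ := Metric.eventually_nhds_iff_ball.mp hev
  have h0 : HasDerivAt c x 0 := by
    have h := hc 0 ⟨neg_lt_zero.mpr hε, hε⟩
    have h2 : formC A.η p (coord p) x = 0 := (formC_coord A.η p x).trans hx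
    rwa [hc0, h2, zero_smul, sub_zero] at h
  -- Taking the minimum with `δ` keeps the curve inside the chart target.
  refine ⟨c, min ε δ, lt_min hε hδ, hc0, h0, fun r hr => ?_⟩
  have hr1 : r ∈ Set.Ioo (-ε) ε :=
    ⟨(neg_le_neg (min_le_left _ _)).trans_lt hr.1, hr.2.trans_le (min_le_left _ _)⟩
  have hr2 : c r ∈ (extChartAt (Mdl (2 * n + 1)) p).target := by
    apply hδ'
    rw [Metric.mem_ball, dist_zero_right, Real.norm_eq_abs, abs_lt]
    exact ⟨(neg_le_neg (min_le_right _ _)).trans_lt hr.1, hr.2.trans_le (min_le_right _ _)⟩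
  have hM := (hasMFDerivAt_pt hr2).comp r (hc r hr1).hasFDerivAt.hasMFDerivAt
  have hM' : HasMFDerivAt 𝓘(ℝ, ℝ) (Mdl (2 * n + 1)) (fun r => pt p (c r)) r _ := hM
  refine ⟨hM'.mdifferentiableAt, ?_⟩
  rw [hM'.mfderiv]
  have hX0 : formC A.η p (c r) (x - formC A.η p (c r) x • vecC A.ξ p (c r)) = 0 := by
    rw [map_sub, map_smul, A.η_vecC hr2, A.η_ξ]
    simp
  refine Eq.trans (congrArg (fun z => A.η (pt p (c r)) (toTangent p (pt p (c r)) z)) ?_) hX0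
  exact one_smul ℝ _

/-- A smooth function with horizontal differential zero is constant along horizontal curves, and
conversely. -/
theorem forall_horizontalCurve_iff {f : M → ℝ} (hf : SmoothFn (d := 2 * n + 1) f) :
    (∀ (γ : ℝ → M) (s t : ℝ), A.IsHorizontalCurve γ s t → ∃ l : ℝ, ∀ r ∈ Set.Ioo s t, f (γ r) = l)
      ↔ ∀ (p : M) (x : TangentSpace (Mdl (2 * n + 1)) p), A.η p x = 0 → diff f p x = 0 := by
  constructor
  · intro h p x hx
    obtain ⟨c, ε, hε, hc0, hc, hγ⟩ := A.exists_isHorizontalCurve p x hx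
    obtain ⟨l, hl⟩ := h _ _ _ hγ
    have h0 : (fun r => f (pt p (c r))) =ᶠ[nhds 0] fun _ => l := by
      filter_upwards [Ioo_mem_nhds (neg_lt_zero.mpr hε) hε] with r hr using hl r hr
    have h1 := (differentiableAt_comp_pt hf p).hasFDerivAt
    rw [← hc0] at h1
    have h2 := h1.comp_hasDerivAt (0 : ℝ) hc
    have h3 := h2.deriv
    refine (diff_eq_fderiv hf p x).trans ?_
    rw [← hc0, ← h3]
    exact h0.deriv_eq.trans (deriv_const _ _)
  · intro h γ s t hγ
    apply isOpen_Ioo.exists_is_const_of_deriv_eq_zero isPreconnected_Ioo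
      (f := fun r => f (γ r))
    · intro r hr
      have := (hf.mdifferentiableAt (by simp) : MDifferentiableAt (Mdl (2 * n + 1)) 𝓘(ℝ, ℝ) f
        (γ r)).comp r (hγ r hr).1
      exact this.differentiableAt.differentiableWithinAt
    · intro r hr
      have h1 := (hf.mdifferentiableAt (by simp) : MDifferentiableAt (Mdl (2 * n + 1)) 𝓘(ℝ, ℝ) f
        (γ r)).hasMFDerivAt.comp r (hγ r hr).1.hasMFDerivAt
      have h2 : HasFDerivAt (fun r => f (γ r)) (_ : ℝ →L[ℝ] ℝ) r := h1.hasFDerivAt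
      exact h2.hasDerivAt.deriv.trans (h _ _ (hγ r hr).2)


/-! ### Traces on an almost contact complex Riemannian manifold -/

theorem trace_g (p : M) : A.trace p (fun x y => A.g p x y) = 2 * n + 1 := by
  have h := metricTrace_self (B := A.g p) (A.g_symm p) (fun _ hx => A.g_eq_zero hx)
  refine Eq.trans h ?_
  push_cast
  rfl

theorem trace_g_smulRight (p : M) (l : TangentSpace (Mdl (2 * n + 1)) p →L[ℝ] ℝ) :
    A.trace p (fun x y => A.η p x * l y) = l (A.ξ p) := by
  have h := metricTrace_smulRight (B := A.g p) (A.g_symm p) (fun _ hx => A.g_eq_zero hx) l (A.ξ p)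
  refine Eq.trans ?_ h
  congr 1
  funext x y
  exact congrArg (· * l y) (A.g_ξ p x).symm

theorem trace_swap (p : M)
    (h : TangentSpace (Mdl (2 * n + 1)) p → TangentSpace (Mdl (2 * n + 1)) p → ℝ) :
    A.trace p (fun x y => h y x) = A.trace p h :=
  metricTrace_swap (B := A.g p) (A.g_symm p) h

theorem trace_add (p : M)
    (h k : TangentSpace (Mdl (2 * n + 1)) p → TangentSpace (Mdl (2 * n + 1)) p → ℝ) :
    A.trace p (fun x y => h x y + k x y) = A.trace p h + A.trace p k :=
  metricTrace_add (d := 2 * n + 1) (A.g p) h k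

theorem trace_const_mul (p : M) (c : ℝ)
    (h : TangentSpace (Mdl (2 * n + 1)) p → TangentSpace (Mdl (2 * n + 1)) p → ℝ) :
    A.trace p (fun x y => c * h x y) = c * A.trace p h :=
  metricTrace_const_mul (d := 2 * n + 1) (A.g p) c h

theorem trace_g_φ (p : M) : A.trace p (fun x y => A.g p x (A.φ p y)) = 0 := by
  have h := metricTrace_apply_right (B := A.g p) (A.g_symm p) (fun _ hx => A.g_eq_zero hx) (A.φ p)
  exact h.trans (trace_phi (φ := A.φ p) (A.φ_ξ p) (A.φ_φ p))

theorem trace_g_φ_φ (p : M) : A.trace p (fun x y => A.g p x (A.φ p (A.φ p y))) = -(2 * n) := by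
  have h := metricTrace_apply_right (B := A.g p) (A.g_symm p) (fun _ hx => A.g_eq_zero hx)
    ((A.φ p).comp (A.φ p))
  refine h.trans ((trace_phi_comp_phi (φ := A.φ p) (A.φ_φ p) (A.η_ξ p)).trans ?_)
  push_cast
  ring

theorem gTilde_apply (p : M) (x y : TangentSpace (Mdl (2 * n + 1)) p) :
    A.gTilde p x y = A.g p x (A.φ p y) + A.η p x * A.η p y :=
  assocForm_apply _ _ _ _ _

theorem trace_gTilde (p : M) : A.trace p (fun x y => A.gTilde p x y) = 1 := by
  simp only [gTilde_apply]
  rw [trace_add, trace_g_φ, trace_g_smulRight, A.η_ξ, zero_add]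

theorem g_φ_left (p : M) (x y : TangentSpace (Mdl (2 * n + 1)) p) :
    A.g p (A.φ p x) y = A.g p x (A.φ p y) := by
  have h := A.g_φ_φ p x (A.φ p y)
  simp only [A.φ_φ, A.η_φ, map_add, map_neg, map_smul, A.g_ξ, smul_eq_mul] at h
  linarith

theorem gTilde_symm (p : M) (x y : TangentSpace (Mdl (2 * n + 1)) p) :
    A.gTilde p x y = A.gTilde p y x := by
  rw [gTilde_apply, gTilde_apply, ← g_φ_left, A.g_symm]
  ring

/-- The Ricci tensor of an almost Riemann soliton. -/
theorem ricci_of_isAlmostRiemannSoliton {ϑ : ∀ p : M, TangentSpace (Mdl (2 * n + 1)) p}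
    {σ : M → ℝ} (h : A.IsAlmostRiemannSoliton ϑ σ) (p : M)
    (hL : ∀ x y, A.lieG ϑ p x y = A.lieG ϑ p y x) (y z : TangentSpace (Mdl (2 * n + 1)) p) :
    2 * A.ricci p y z =
      -(4 * n * σ p + A.trace p (A.lieG ϑ p)) * A.g p y z - (2 * n - 1) * A.lieG ϑ p y z := by
  let L : Bil (2 * n + 1) := lieBil (vecC ϑ p) (bilC A.g p) (coord p)
  have hLe : ∀ x y, L x y = A.lieG ϑ p x y := fun x y => lieBil_apply _ _ _ _ _
  have hLf : (fun x y => L x y) = A.lieG ϑ p := funext fun x => funext fun y => hLe x y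
  have hLt : A.trace p (A.lieG ϑ p) = metricTrace (d := 2 * n + 1) (A.g p) (fun x t => L x t) :=
    congrArg (metricTrace (d := 2 * n + 1) (A.g p)) hLf.symm
  have hs : ∀ x y, L x y = L y x := fun x y => by rw [hLe, hLe]; exact hL x y
  have hR : ∀ x y z t, 2 * A.R p x y z t
      + σ p * kulkarniNomizu (fun a b => A.g p a b) (fun a b => A.g p a b) x y z t
      + kulkarniNomizu (fun a b => A.g p a b) (fun a b => L a b) x y z t = 0 := by
    intro x y z t
    have h1 := h.2.2 p x y z t
    rw [← hLf] at h1
    exact h1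
  have h3 := metricTrace_of_soliton (B := A.g p) (A.g_symm p) (fun _ hx => A.g_eq_zero hx) hs hR y z
  have h4 : L y z = A.lieG ϑ p y z := hLe y z
  have h5 : 2 * A.ricci p y z = -(2 * ((2 * n + 1 : ℕ) - 1) * σ p + A.trace p (A.lieG ϑ p))
      * A.g p y z - ((2 * n + 1 : ℕ) - 2) * A.lieG ϑ p y z := by
    rw [hLt, ← h4]
    exact h3
  rw [h5]
  push_cast
  ring

/-! ### The Ricci tensor of the soliton on a `G(𝓕₀)`-manifold. -/

section Transform

variable {u v w : M → ℝ} (hu : SmoothFn (d := 2 * n + 1) u)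
  (hv : SmoothFn (d := 2 * n + 1) v) (hw : SmoothFn (d := 2 * n + 1) w)

include hu hv hw in
/-- The Ricci tensor of a `G(𝓕₀)`-manifold which is an almost Riemann soliton with vertical
potential `k ξ̄`. -/
theorem ricci_gTransform (hA : A.IsF0) {k σ : M → ℝ} (hk : SmoothFn (d := 2 * n + 1) k)
    {B : AccRStructure n M} (hB : B = A.gTransform u v w hu hv hw)
    (hS : B.IsAlmostRiemannSoliton (fun p => k p • B.ξ p) σ) (p : M)
    (x y : TangentSpace (Mdl (2 * n + 1)) p) :
    B.ricci p x y =
      -(2 * n * σ p + diff k p (B.ξ p) + (4 * n - 1) * k p * diff u p (B.ξ p)) * B.g p x y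
      - (2 * n - 1) * k p * diff v p (B.ξ p) * B.gTilde p x y
      - (2 * n - 1) * k p * (diff w p (B.ξ p) - diff u p (B.ξ p) - diff v p (B.ξ p))
        * (B.η p x * B.η p y)
      - (2 * n - 1) / 2 * ((diff k p x - k p * diff w p x) * B.η p y
        + B.η p x * (diff k p y - k p * diff w p y)) := by
  have hL := A.lieG_gTransform hu hv hw hA hk hB p
  have hsymm : ∀ a b, B.lieG (fun p => k p • B.ξ p) p a b
      = B.lieG (fun p => k p • B.ξ p) p b a := by
    intro a b
    rw [hL, hL, B.g_symm p a b, B.gTilde_symm p a b]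
    ring
  have ht1 : B.trace p (fun a b => B.η p a * (diff k p b - k p * diff w p b)) =
      diff k p (B.ξ p) - k p * diff w p (B.ξ p) := by
    let l : TangentSpace (Mdl (2 * n + 1)) p →L[ℝ] ℝ := diff k p - k p • diff w p
    have hl : ∀ b, l b = diff k p b - k p * diff w p b := fun b => by
      simp only [l, sub_apply, smul_apply, smul_eq_mul]
    simpa only [hl] using B.trace_g_smulRight p l
  have ht2 : B.trace p (fun a b => (diff k p a - k p * diff w p a) * B.η p b) =
      diff k p (B.ξ p) - k p * diff w p (B.ξ p) := by
    rw [← ht1, ← trace_swap]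
    congr 1
    funext a b
    ring
  -- The traces of `ḡ`, its associated metric and `η̄ ⊗ η̄` are `2n + 1`, `1` and `1`, so the `dv`
  -- and `dw` terms cancel.
  have ht : B.trace p (B.lieG (fun p => k p • B.ξ p) p) =
      4 * n * k p * diff u p (B.ξ p) + 2 * diff k p (B.ξ p) := by
    have e : B.lieG (fun p => k p • B.ξ p) p = fun a b => _ := funext fun a => funext fun b => hL a b
    rw [e, trace_add, trace_add, trace_add, trace_add, trace_const_mul, trace_const_mul,
      trace_const_mul, trace_g, trace_gTilde, trace_g_smulRight, ht1, ht2, B.η_ξ]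
    ring
  have h := B.ricci_of_isAlmostRiemannSoliton hS p hsymm x y
  rw [hL, ht] at h
  linarith

end Transform



/-- `k = λ e^w` on `𝓗` if and only if `dk = k dw` on `𝓗`. -/
theorem eqConstMulOnH_exp_iff {k w : M → ℝ} (hk : SmoothFn (d := 2 * n + 1) k)
    (hw : SmoothFn (d := 2 * n + 1) w) :
    A.EqConstMulOnH k (fun p => Real.exp (w p)) ↔
      ∀ (p : M) (x : TangentSpace (Mdl (2 * n + 1)) p), A.η p x = 0 →
        diff k p x - k p * diff w p x = 0 := by
  -- `k = λ e^w` along a curve says that `k e^{-w}` is the constant `λ`; its differential is `e^{-w}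
  -- (dk - k dw)`.
  have h := A.forall_horizontalCurve_iff (smoothFn_mul_exp_neg hk hw)
  have h1 : ∀ (p : M) (x : TangentSpace (Mdl (2 * n + 1)) p),
      diff (fun q => k q * Real.exp (-w q)) p x = 0 ↔ diff k p x - k p * diff w p x = 0 := by
    intro p x
    have h2 : diff (fun q => k q * Real.exp (-w q)) p x
      = Real.exp (-w p) * (diff k p x - k p * diff w p x) := diff_mul_exp_neg hk hw p x
    rw [h2, mul_eq_zero, or_iff_right (Real.exp_ne_zero _)]
  simp only [h1] at h
  rw [← h]
  refine forall₄_congr fun γ s t _ => exists_congr fun l => forall₂_congr fun r _ => ?_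
  rw [Real.exp_neg, ← div_eq_mul_inv, div_eq_iff (Real.exp_ne_zero _)]

/-- A 1-form vanishing on `𝓗` is a multiple of `η`. -/
theorem eq_mul_η {p : M} (l : TangentSpace (Mdl (2 * n + 1)) p →L[ℝ] ℝ)
    (hl : ∀ x, A.η p x = 0 → l x = 0) (x : TangentSpace (Mdl (2 * n + 1)) p) :
    l x = l (A.ξ p) * A.η p x := by
  have h := hl (x - A.η p x • A.ξ p) (by simp [A.η_ξ])
  rw [map_sub, map_smul, smul_eq_mul, sub_eq_zero] at h
  rw [h, mul_comm]

/-! ### The Einstein-like criterion. -/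

section Transform

variable {u v w : M → ℝ} (hu : SmoothFn (d := 2 * n + 1) u)
  (hv : SmoothFn (d := 2 * n + 1) v) (hw : SmoothFn (d := 2 * n + 1) w) (hA : A.IsF0)
  {k σ : M → ℝ} (hk : SmoothFn (d := 2 * n + 1) k)
  {B : AccRStructure n M} (hB : B = A.gTransform u v w hu hv hw)
  (hS : B.IsAlmostRiemannSoliton (fun p => k p • B.ξ p) σ)

include hA hk hB hS

/-- On the pair `(x, ξ̄)` with `x` horizontal, `ḡ`, its associated metric and `η̄ ⊗ η̄` all vanish,
so only the mixed term of `ρ̄` survives. -/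
theorem diff_eq_zero_of_isAlmostEinsteinLike (hE : B.IsAlmostEinsteinLike) (p : M)
    (x : TangentSpace (Mdl (2 * n + 1)) p) (hx : B.η p x = 0) :
    diff k p x - k p * diff w p x = 0 := by
  obtain ⟨a, b, c, h⟩ := hE
  have h1 := A.ricci_gTransform hu hv hw hA hk hB hS p x (B.ξ p)
  rw [h p x (B.ξ p), B.gTilde_apply, B.φ_ξ, map_zero, B.g_ξ, hx, B.η_ξ] at h1
  have h2 : (2 * (n : ℝ) - 1) * (diff k p x - k p * diff w p x) = 0 := by linarith
  refine (mul_eq_zero.mp h2).resolve_left fun h3 => ?_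
  -- Parity excludes `2n = 1`, also for `n = 0`.
  have h4 : 2 * n = 1 := by exact_mod_cast sub_eq_zero.mp h3
  omega

/-- Now `dk - k dw` is its value at `ξ̄` times `η̄`, so the mixed term merges with the `η̄ ⊗ η̄`
term and `dw(ξ̄)` drops out. -/
theorem ricci_gTransform_of_diff_eq_zero
    (hH : ∀ (p : M) (x : TangentSpace (Mdl (2 * n + 1)) p), B.η p x = 0 →
      diff k p x - k p * diff w p x = 0) (p : M) (x y : TangentSpace (Mdl (2 * n + 1)) p) :
    B.ricci p x y =
      -(2 * n * σ p + diff k p (B.ξ p) + (4 * n - 1) * k p * diff u p (B.ξ p)) * B.g p x y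
        - (2 * n - 1) * k p * diff v p (B.ξ p) * B.gTilde p x y
        - (2 * n - 1) * (diff k p (B.ξ p) - k p * (diff u p (B.ξ p) + diff v p (B.ξ p)))
          * (B.η p x * B.η p y) := by
  let l : TangentSpace (Mdl (2 * n + 1)) p →L[ℝ] ℝ := diff k p - k p • diff w p
  have hl : ∀ b, l b = diff k p b - k p * diff w p b := fun b => by
    simp only [l, sub_apply, smul_apply, smul_eq_mul]
  have h := B.eq_mul_η l fun x hx => (hl x).trans (hH p x hx)
  simp only [hl] at h
  rw [A.ricci_gTransform hu hv hw hA hk hB hS p x y, h x, h y]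
  ring

theorem isAlmostEinsteinLike_gTransform_iff :
    B.IsAlmostEinsteinLike ↔ ∀ (p : M) (x : TangentSpace (Mdl (2 * n + 1)) p), B.η p x = 0 →
      diff k p x - k p * diff w p x = 0 := by
  refine ⟨A.diff_eq_zero_of_isAlmostEinsteinLike hu hv hw hA hk hB hS, fun hH => ?_⟩
  refine ⟨fun p => -(2 * n * σ p + diff k p (B.ξ p) + (4 * n - 1) * k p * diff u p (B.ξ p)),
    fun p => -((2 * n - 1) * k p * diff v p (B.ξ p)),
    fun p => -((2 * n - 1) * (diff k p (B.ξ p) - k p * (diff u p (B.ξ p) + diff v p (B.ξ p)))),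
    fun p x y => ?_⟩
  rw [A.ricci_gTransform_of_diff_eq_zero hu hv hw hA hk hB hS hH]
  ring

end Transform

/-- The scalar curvature of an almost Einstein-like manifold. -/
theorem scal_of_ricci_eq {p : M} {a b c : ℝ}
    (h : ∀ x y, A.ricci p x y = a * A.g p x y + b * A.gTilde p x y + c * (A.η p x * A.η p y)) :
    A.scal p = a * (2 * n + 1) + b + c := by
  unfold scal
  simp only [h]
  rw [trace_add, trace_add, trace_const_mul, trace_const_mul, trace_const_mul, trace_g,
    trace_gTilde, trace_g_smulRight, A.η_ξ]
  ring

/-- The `*`-scalar curvature of an almost Einstein-like manifold. -/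
theorem scalStar_of_ricci_eq {p : M} {a b c : ℝ}
    (h : ∀ x y, A.ricci p x y = a * A.g p x y + b * A.gTilde p x y + c * (A.η p x * A.η p y)) :
    A.scalStar p = -(2 * n) * b := by
  unfold scalStar
  -- With `φ` in the second slot the `η` terms die, leaving `a g(x, φ y) + b g(x, φ² y)`.
  simp only [h, gTilde_apply, A.η_φ, mul_zero, add_zero]
  rw [trace_add, trace_const_mul, trace_const_mul, trace_g_φ, trace_g_φ_φ]
  ring

end AccRStructure
end AccR
end

theorem mainTheorem3 {n : ℕ} {M : Type*} [TopologicalSpace M]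
    [ChartedSpace (AccR.V (2 * n + 1)) M] [IsManifold (AccR.Mdl (2 * n + 1)) ∞ M]
    (A : AccR.AccRStructure n M) (hA : A.IsF0)
    (u v w : M → ℝ) (hu : AccR.SmoothFn (d := 2 * n + 1) u)
    (hv : AccR.SmoothFn (d := 2 * n + 1) v) (hw : AccR.SmoothFn (d := 2 * n + 1) w)
    (B : AccR.AccRStructure n M) (hB : B = A.gTransform u v w hu hv hw)
    (k σ : M → ℝ) (hk : AccR.SmoothFn (d := 2 * n + 1) k) (hk0 : ∀ p, k p ≠ 0)
    (hS : B.IsAlmostRiemannSoliton (fun p => k p • B.ξ p) σ) :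
    (B.IsAlmostEinsteinLike ↔ B.EqConstMulOnH k (fun p => Real.exp (w p))) ∧
    (B.IsAlmostEinsteinLike → ∀ p : M,
      (∀ x y : TangentSpace (AccR.Mdl (2 * n + 1)) p,
        B.ricci p x y =
          -(2 * n * σ p + AccR.diff k p (B.ξ p)
              + (4 * n - 1) * k p * AccR.diff u p (B.ξ p)) * B.g p x y
            - (2 * n - 1) * k p * AccR.diff v p (B.ξ p) * B.gTilde p x y
            - (2 * n - 1) * (AccR.diff k p (B.ξ p)
                - k p * (AccR.diff u p (B.ξ p) + AccR.diff v p (B.ξ p)))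
              * (B.η p x * B.η p y)) ∧
      B.scal p =
        -2 * n * ((2 * n + 1) * σ p + 2 * AccR.diff k p (B.ξ p)
          + 4 * n * k p * AccR.diff u p (B.ξ p)) ∧
      B.scalStar p = 2 * n * (2 * n - 1) * k p * AccR.diff v p (B.ξ p)) := by
  have hiff := A.isAlmostEinsteinLike_gTransform_iff hu hv hw hA hk hB hS
  refine ⟨hiff.trans (B.eqConstMulOnH_exp_iff hk hw).symm, fun hE p => ?_⟩
  have hric := A.ricci_gTransform_of_diff_eq_zero hu hv hw hA hk hB hS (hiff.mp hE) p
  have hric' : ∀ x y, B.ricci p x y =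
      -(2 * n * σ p + AccR.diff k p (B.ξ p)
          + (4 * n - 1) * k p * AccR.diff u p (B.ξ p)) * B.g p x y
        + -((2 * n - 1) * k p * AccR.diff v p (B.ξ p)) * B.gTilde p x y
        + -((2 * n - 1) * (AccR.diff k p (B.ξ p)
            - k p * (AccR.diff u p (B.ξ p) + AccR.diff v p (B.ξ p))))
          * (B.η p x * B.η p y) := fun x y => by
    rw [hric]
    ring
  refine ⟨hric, ?_, ?_⟩
  · rw [B.scal_of_ricci_eq hric']
    ring
  · rw [B.scalStar_of_ricci_eq hric']
    ring
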